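/- **Setting.** Let $\mathcal{M}=(\mathcal S,\mathcal A,\mathcal B,P,r,\gamma)$ be a discounted zero-sum two-player Markov game with discrete state space $\mathcal S$, finite nonempty action sets $\mathcal A$ (maximizing player) and $\mathcal B$ (minimizing player), transition kernel $P(\cdot\mid s,a,b)$, rewards $r(s,a,b)\in[0,1]$ and discount factor $\gamma\in[0,1)$. Let $\tau>0$ and $\mathcal H(p)=-\sum_i p_i\log p_i$. For policies $\mu:\mathcal S\to\Delta(\mathcal A)$, $\nu:\mathcal S\to\Delta(\mathcal B)$ put $$V_\tau^{\mu,\nu}(s)=\mathbb E\Big[\sum_{t\ge0}\gamma^t\big(r(s_t,a_t,b_t)-\tau\log\mu(a_t|s_t)+\tau\log\nu(b_t|s_t)\big)\,\Big|\,s_0=s\Big],$$ $$Q_\tau^{\mu,\nu}(s,a,b)=r(s,a,b)+\gamma\,\mathbb E_{s'\sim P(\cdot|s,a,b)}V_\tau^{\mu,\nu}(s').$$ A quantal response equilibrium (QRE) is a pair $(\mu_\tau^\star,\nu_\tau^\star)$ with $V_\tau^{\mu,\nu_\tau^\star}(s)\le V_\tau^{\mu_\tau^\star,\nu_\tau^\star}(s)\le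 V_\tau^{\mu_\tau^\star,\nu}(s)$ for all $s,\mu,\nu$, and $Q_\tau^\star=Q_\tau^{\mu_\tau^\star,\nu_\tau^\star}$. **Inner methods.** For a matrix $Q\in\mathbb R^{\mathcal A\times\mathcal B}$ let $f_\tau(Q;\mu,\nu)=\mu^\top Q\nu+\tau\mathcal H(\mu)-\tau\mathcal H(\nu)$. With learning rate $\eta$, start from the uniform distributions $\mu^{(0)}=\bar\mu^{(0)}$, $\nu^{(0)}=\bar\nu^{(0)}$ and iterate $$\bar\mu^{(t+1)}(a)\propto\mu^{(t)}(a)^{1-\eta\tau}e^{\eta[Qz_2]_a},\qquad \bar\nu^{(t+1)}(b)\propto\nu^{(t)}(b)^{1-\eta\tau}e^{-\eta[Q^\top z_1]_b},$$ $$\mu^{(t+1)}(a)\propto\mu^{(t)}(a)^{1-\eta\tau}e^{\eta[Q\bar\nu^{(t+1)}]_a},\qquad \nu^{(t+1)}(b)\propto\nu^{(t)}(b)^{1-\eta\tau}e^{-\eta[Q^\top\bar\mu^{(t+1)}]_b},$$ where $(z_1,z_2)=(\mu^{(t)},\nu^{(t)})$ for PU (predictive update) and $(z_1,z_2)=(\bar\mu^{(t)},\bar\nu^{(t)})$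 for OMWU (optimistic multiplicative weights update). **Approximate soft value iteration.** Put $Q^{(0)}=0$. Given $Q^{(t)}$, run PU (or OMWU) for $T_{\rm sub}$ iterations on the matrix $Q^{(t)}(s)=Q^{(t)}(s,\cdot,\cdot)$ of every state $s$, let $V^{(t+1)}(s)=f_\tau\big(Q^{(t)}(s);\bar\mu^{(T_{\rm sub})}(s),\bar\nu^{(T_{\rm sub})}(s)\big)$ for the resulting midpoints, and set $Q^{(t+1)}(s,a,b)=r(s,a,b)+\gamma\,\mathbb E_{s'\sim P(\cdot|s,a,b)}V^{(t+1)}(s')$. **Theorem.** There is an absolute constant $C>0$ such that the following holds. Let $|\mathcal A|\ge 2$, $\gamma\in[0,1)$, $0<\tau\le1$, $0<\epsilon\le\frac12$ and $$\eta=\frac{1-\gamma}{2\big(1+\tau(\log|\mathcal A|+1-\gamma)\big)}.$$ There are integers $T_{\rm main},T_{\rm sub}\ge1$, depending only on $|\mathcal A|,\gamma,\tau,\epsilon$, with $$T_{\rm main}\cdot T_{\rm sub}\le C\,\frac{\log|\mathcal A|+1/\tau}{(1-\gamma)^2}\Big(\log\frac{\log|\mathcal A|}{(1-\gamma)\epsilon}\Big)^2,$$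 such that for every Markov game as above with $|\mathcal A|\ge|\mathcal B|$, a QRE exists, and approximate soft value iteration with learning rate $\eta$, with either PU or OMWU as inner method, satisfies $\|Q^{(T_{\rm main})}-Q_\tau^\star\|_\infty\le\epsilon$. The same accuracy holds if $T_{\rm main}$, $T_{\rm sub}$ are replaced by any larger numbers of outer and inner iterations. -/

import Mathlib

namespace EntropyGame

/-! ### Entropy-regularized zero-sum matrix games -/

section MatrixGame

variable {A B : Type*} [Fintype A] [Fintype B]

/-- Shannon entropy of a vector (with the convention `0 log 0 = 0`). -/
noncomputable def entropy {I : Type*} [Fintype I] (p : I → ℝ) : ℝ :=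
  -∑ i, p i * Real.log (p i)

/-- The uniform distribution. -/
noncomputable def uniform (I : Type*) [Fintype I] : I → ℝ :=
  fun _ => 1 / (Fintype.card I : ℝ)

/-- The entropy-regularized payoff `μᵀ Q ν + τ H(μ) - τ H(ν)`;
`μ` is the maximizing and `ν` the minimizing player. -/
noncomputable def regPayoff (τ : ℝ) (Q : Matrix A B ℝ) (μ : A → ℝ) (ν : B → ℝ) : ℝ :=
  dotProduct μ (Q.mulVec ν) + τ * entropy μ - τ * entropy ν

/-- One multiplicative update: the distribution proportional to
`i ↦ p i ^ (1 - η τ) * exp (η * g i)`. -/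
noncomputable def multUpdate {I : Type*} [Fintype I] (η τ : ℝ) (p g : I → ℝ) : I → ℝ :=
  fun i => p i ^ (1 - η * τ) * Real.exp (η * g i) /
    ∑ j, p j ^ (1 - η * τ) * Real.exp (η * g j)

/-- The two matrix-game methods: predictive update and optimistic multiplicative weights. -/
inductive Method
  | PU
  | OMWU

/-- The quantities maintained by the methods: `(μ, ν)` and the midpoints `(μbar, νbar)`. -/
structure Iterate (A B : Type*) where
  μ : A → ℝ
  ν : B → ℝ
  μbar : A → ℝ
  νbar : B → ℝ

/-- All four components start at the uniform distribution. (For PU the initial midpoint is never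
used by the updates.) -/
noncomputable def Iterate.init (A B : Type*) [Fintype A] [Fintype B] : Iterate A B where
  μ := uniform A
  ν := uniform B
  μbar := uniform A
  νbar := uniform B

/-- The opponents' policies `(z₁, z₂)` against which the midpoint is computed: the current
policies for PU, the previous midpoints for OMWU. -/
def Method.prediction (m : Method) (x : Iterate A B) : (A → ℝ) × (B → ℝ) :=
  match m with
  | .PU => (x.μ, x.ν)
  | .OMWU => (x.μbar, x.νbar)

/-- One iteration of PU or OMWU on the matrix game with payoff matrix `Q`. -/
noncomputable def Method.step (m : Method) (η τ : ℝ) (Q : Matrix A B ℝ) (x : Iterate A B) :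
    Iterate A B :=
  let z := m.prediction x
  let μbar := multUpdate η τ x.μ (Q.mulVec z.2)
  let νbar := multUpdate η τ x.ν (-(Q.transpose.mulVec z.1))
  { μ := multUpdate η τ x.μ (Q.mulVec νbar)
    ν := multUpdate η τ x.ν (-(Q.transpose.mulVec μbar))
    μbar := μbar
    νbar := νbar }

/-- The state of PU or OMWU after `T` iterations from the uniform initialization. -/
noncomputable def Method.run (m : Method) (η τ : ℝ) (Q : Matrix A B ℝ) (T : ℕ) : Iterate A B :=
  (m.step η τ Q)^[T] (Iterate.init A B)

end MatrixGame

/-! ### Entropy-regularized zero-sum Markov games -/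

/-- A discounted zero-sum two-player Markov game with discrete state space `S`, action spaces
`A` (maximizing player) and `B` (minimizing player), transition probabilities `P s a b s'`, rewards
in `[0, 1]` and discount factor in `[0, 1)`. -/
structure MarkovGame (S A B : Type*) where
  P : S → A → B → S → ℝ
  P_nonneg : ∀ s a b s', 0 ≤ P s a b s'
  P_hasSum : ∀ s a b, HasSum (P s a b) 1
  r : S → A → B → ℝ
  r_nonneg : ∀ s a b, 0 ≤ r s a b
  r_le_one : ∀ s a b, r s a b ≤ 1
  γ : ℝ
  γ_nonneg : 0 ≤ γ
  γ_lt_one : γ < 1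

/-- A (stationary) policy assigns to each state a distribution over actions. -/
abbrev Policy (S I : Type*) [Fintype I] := S → stdSimplex ℝ I

namespace MarkovGame

variable {S A B : Type*} (M : MarkovGame S A B)

/-- From state values to state-action values: `r(s,a,b) + γ 𝔼_{s' ∼ P(·|s,a,b)} V(s')`. -/
noncomputable def backup (V : S → ℝ) (s : S) : Matrix A B ℝ :=
  fun a b => M.r s a b + M.γ * ∑' s', M.P s a b s' * V s'

variable [Fintype A] [Fintype B]

open Classical in
/-- `stateLaw M μ ν s₀ t s` is the probability that `s_t = s` when the trajectory starts at `s₀` and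
the players follow the policies `μ` and `ν`. -/
noncomputable def stateLaw (μ : Policy S A) (ν : Policy S B) (s₀ : S) : ℕ → S → ℝ
  | 0 => fun s => if s = s₀ then 1 else 0
  | t + 1 => fun s' =>
      ∑' s, stateLaw μ ν s₀ t s * ∑ a, ∑ b, μ s a * ν s b * M.P s a b s'

/-- The conditional expectation, given `s_t = s`, of the regularized reward
`r(s_t,a_t,b_t) - τ log μ(a_t|s_t) + τ log ν(b_t|s_t)`. -/
noncomputable def regReward (τ : ℝ) (μ : Policy S A) (ν : Policy S B) (s : S) : ℝ :=
  ∑ a, ∑ b, μ s a * ν s b *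
    (M.r s a b - τ * Real.log (μ s a) + τ * Real.log (ν s b))

/-- The soft value function: the expected discounted sum of the regularized rewards along
the trajectory started at `s₀`. -/
noncomputable def softV (τ : ℝ) (μ : Policy S A) (ν : Policy S B) (s₀ : S) : ℝ :=
  ∑' t : ℕ, M.γ ^ t * ∑' s, M.stateLaw μ ν s₀ t s * M.regReward τ μ ν s

/-- The soft Q-function of a policy pair. -/
noncomputable def softQ (τ : ℝ) (μ : Policy S A) (ν : Policy S B) : S → Matrix A B ℝ :=
  M.backup (M.softV τ μ ν)

/-- Quantal response equilibrium: `(μ, ν)` is a saddle point of the soft value at every state, so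
that `softV τ μ ν` is the minimax soft value and `softQ τ μ ν` the optimal minimax soft Q-function
(the same for all equilibria). -/
def IsQRE (τ : ℝ) (μ : Policy S A) (ν : Policy S B) : Prop :=
  ∀ s, (∀ μ' : Policy S A, M.softV τ μ' ν s ≤ M.softV τ μ ν s) ∧
    (∀ ν' : Policy S B, M.softV τ μ ν s ≤ M.softV τ μ ν' s)

/-- The iterates `Q^(t)` of approximate soft value iteration: `Q^(0) = 0`; given `Q^(t)`, the
method is run for `Tsub` iterations on the matrix game `Q^(t)(s)` of every state `s`, `V^(t+1)(s)` is
the regularized payoff of the last midpoint, and `Q^(t+1) = r + γ 𝔼 V^(t+1)`. -/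
noncomputable def approxVI (m : Method) (η τ : ℝ) (Tsub : ℕ) : ℕ → S → Matrix A B ℝ
  | 0 => fun _ => 0
  | t + 1 => M.backup fun s =>
      let Q := approxVI m η τ Tsub t s
      let out := m.run η τ Q Tsub
      regPayoff τ Q out.μbar out.νbar

end MarkovGame

end EntropyGame

/-! Soft value iteration is a `γ`-contraction whose Bellman operator is the saddle value of a
regularized matrix game in each state. That value is nonexpansive in the payoff matrix. So an inner
solver of accuracy `δ` gives outer error at most `γ ^ t * q + δ / (1 - γ)`, where `q` bounds all
payoff matrices that occur (`abs_approxVI_sub_le`).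

The inner solver is analysed with a Lyapunov function: relative entropy from the saddle point to the
current policies plus relative entropy from the midpoints to the policies. Summing the three-point
identities of the two players cancels the bilinear terms, since the game is zero-sum. The error from
predicting the opponent is quadratic in `η * q` and is absorbed once `η * (2 * q + τ) ≤ 1`. The
potential therefore shrinks by the factor `1 - η * τ` (`Method.potential_step_le`). PU and OMWU
differ only in how close the prediction is to the midpoint, and one estimate covers both
(`Method.prediction_sq_le`).

The value gap at the midpoints also involves the reverse divergences from midpoints to saddle point,
weighted by `τ`. The potential does not contain them, but its decrease leaves a surplus of exactly
`η * τ` times them, so the gap is bounded by the potential over `η` with no further loss.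

A QRE is built from statewise saddle points at the fixed point of the optimal Bellman operator. All
QREs share one value, so the bound applies to every one of them. The rest is the choice of iteration
counts, each proportional to `L = log (log |A| / ((1 - γ) * ε))`. -/

namespace EntropyGame

open Finset Filter Topology

/-! ### Relative entropy, Pinsker's inequality and Gibbs distributions. -/

section RelativeEntropy

variable {I : Type*} [Fintype I]

/-- The relative entropy (Kullback-Leibler divergence) of two vectors. -/
noncomputable def relEntropy (p q : I → ℝ) : ℝ :=
  ∑ i, p i * (Real.log (p i) - Real.log (q i))

/-- The `ℓ¹` distance of two vectors. -/
noncomputable def l1Dist (p q : I → ℝ) : ℝ := ∑ i, |p i - q i|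

/-- A probability vector with full support. -/
structure IsPosDist (p : I → ℝ) : Prop where
  pos : ∀ i, 0 < p i
  sum_eq_one : ∑ i, p i = 1

theorem IsPosDist.mem_stdSimplex {p : I → ℝ} (hp : IsPosDist p) : p ∈ stdSimplex ℝ I :=
  ⟨fun i => (hp.pos i).le, hp.sum_eq_one⟩

theorem l1Dist_nonneg (p q : I → ℝ) : 0 ≤ l1Dist p q :=
  sum_nonneg fun _ _ => abs_nonneg _

theorem l1Dist_comm (p q : I → ℝ) : l1Dist p q = l1Dist q p :=
  sum_congr rfl fun _ _ => abs_sub_comm _ _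

theorem l1Dist_triangle (p q r : I → ℝ) : l1Dist p r ≤ l1Dist p q + l1Dist q r := by
  unfold l1Dist
  rw [← sum_add_distrib]
  exact sum_le_sum fun i _ => abs_sub_le _ _ _

theorem relEntropy_self (p : I → ℝ) : relEntropy p p = 0 := by simp [relEntropy]

/-- The function vanishes at `1` and its derivative has the sign of `(y - 1) ^ 3`, so `1` is its
minimum. This is the scalar core of Pinsker's inequality. -/
theorem log_rational_lower_bound {x : ℝ} (hx : 0 < x) :
    0 ≤ Real.log x - 5 / 2 + 1 / (4 * x) + 27 / (4 * (x + 2)) := by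
  set G : ℝ → ℝ := fun x => Real.log x - 5 / 2 + 1 / (4 * x) + 27 / (4 * (x + 2)) with hG
  have hderiv : ∀ y : ℝ, 0 < y → HasDerivAt G ((y - 1) ^ 3 / (y ^ 2 * (y + 2) ^ 2)) y := by
    intro y hy
    have h1 := ((Real.hasDerivAt_log hy.ne').sub_const (5 / 2))
    have h2 : HasDerivAt (fun y : ℝ => 1 / (4 * y)) (-1 / (4 * y ^ 2)) y := by
      refine ((hasDerivAt_const y (1 : ℝ)).div ((hasDerivAt_id y).const_mul 4)
        (by simpa using hy.ne')).congr_deriv ?_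
      simp only [id_eq]
      field_simp
      ring
    have h3 : HasDerivAt (fun y : ℝ => 27 / (4 * (y + 2))) (-27 / (4 * (y + 2) ^ 2)) y := by
      refine ((hasDerivAt_const y (27 : ℝ)).div (((hasDerivAt_id y).add_const 2).const_mul 4)
        (by simp only [id_eq]; positivity)).congr_deriv ?_
      simp only [id_eq]
      field_simp
      ring
    refine ((h1.add h2).add h3).congr_deriv ?_
    field_simp
    ring
  have h1 : G 1 = 0 := by norm_num [hG]
  change 0 ≤ G x
  rw [← h1]
  rcases le_total 1 x with h | h
  · refine monotoneOn_of_deriv_nonneg (convex_Ici 1) ?_ ?_ ?_ (Set.mem_Ici.2 le_rfl) h h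
    · exact fun y hy => (hderiv y (by grind)).continuousAt.continuousWithinAt
    · intro y hy
      rw [interior_Ici] at hy
      exact (hderiv y (by grind)).differentiableAt.differentiableWithinAt
    · intro y hy
      rw [interior_Ici, Set.mem_Ioi] at hy
      rw [(hderiv y (by linarith)).deriv]
      have : 0 ≤ y - 1 := by linarith
      positivity
  · refine antitoneOn_of_deriv_nonpos (convex_Ioc 0 1) ?_ ?_ ?_ ⟨hx, h⟩ ⟨one_pos, le_rfl⟩ h
    · exact fun y hy => (hderiv y hy.1).continuousAt.continuousWithinAt
    · intro y hy
      exact (hderiv y (interior_subset hy).1).differentiableAt.differentiableWithinAt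
    · intro y hy
      have hy' := interior_subset hy
      rw [(hderiv y hy'.1).deriv]
      have h2 : (y - 1) ^ 3 ≤ 0 := by
        have : 0 ≤ (1 - y) ^ 3 := pow_nonneg (by linarith [hy'.2]) 3
        nlinarith
      exact div_nonpos_of_nonpos_of_nonneg h2 (by positivity)

/-- For `p > 0` the difference of the two sides is a positive multiple of the function in
`log_rational_lower_bound` at `p / q`. The product form is the one needed for Cauchy-Schwarz. -/
theorem sq_sub_le_mul_relEntropy_term {p q : ℝ} (hp : 0 ≤ p) (hq : 0 < q) :
    |p - q| ^ 2 ≤ (2 * p + 4 * q) / 3 * (p * (Real.log p - Real.log q) - p + q) := by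
  rw [sq_abs]
  rcases hp.eq_or_lt with rfl | hp
  · simp only [zero_mul]
    nlinarith [mul_pos hq hq]
  · have h := log_rational_lower_bound (div_pos hp hq)
    rw [Real.log_div hp.ne' hq.ne'] at h
    set l := Real.log p - Real.log q
    have h2 : (2 * p + 4 * q) / 3 * (p * l - p + q) - (p - q) ^ 2 =
        (2 * p + 4 * q) / 3 * p *
          (l - 5 / 2 + 1 / (4 * (p / q)) + 27 / (4 * (p / q + 2))) := by
      have : p / q + 2 = (p + 2 * q) / q := by field_simp
      rw [this]
      have : p + 2 * q ≠ 0 := by positivity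
      field_simp
      ring
    have h3 : 0 ≤ (2 * p + 4 * q) / 3 * p *
          (l - 5 / 2 + 1 / (4 * (p / q)) + 27 / (4 * (p / q + 2))) :=
      mul_nonneg (by positivity) h
    linarith

/-- Pinsker's inequality. -/
theorem l1Dist_sq_le {p q : I → ℝ} (hp : p ∈ stdSimplex ℝ I) (hq : IsPosDist q) :
    l1Dist p q ^ 2 ≤ 2 * relEntropy p q := by
  -- Cauchy-Schwarz: the weights `(2 * p i + 4 * q i) / 3` have total mass `2`, the constant in
  -- Pinsker's inequality.
  have h := sum_sq_le_sum_mul_sum_of_sq_le_mul (univ : Finset I)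
    (r := fun i => |p i - q i|) (f := fun i => (2 * p i + 4 * q i) / 3)
    (g := fun i => p i * (Real.log (p i) - Real.log (q i)) - p i + q i) ?_ ?_ ?_
  · have h1 : ∑ i, (2 * p i + 4 * q i) / 3 = 2 := by
      rw [← sum_div, sum_add_distrib, ← mul_sum, ← mul_sum, hp.2, hq.sum_eq_one]
      norm_num
    have h2 : ∑ i, (p i * (Real.log (p i) - Real.log (q i)) - p i + q i) = relEntropy p q := by
      rw [sum_add_distrib, sum_sub_distrib, hp.2, hq.sum_eq_one]
      simp [relEntropy]
    rwa [h1, h2] at h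
  · intro i _
    have := hp.1 i
    have := (hq.pos i).le
    positivity
  · intro i _
    have h1 := sq_sub_le_mul_relEntropy_term (hp.1 i) (hq.pos i)
    have h2 : 0 < (2 * p i + 4 * q i) / 3 := by
      have := hp.1 i
      have := hq.pos i
      positivity
    exact nonneg_of_mul_nonneg_right (h1.trans' (sq_nonneg _)) h2
  · exact fun i _ => sq_sub_le_mul_relEntropy_term (hp.1 i) (hq.pos i)

theorem relEntropy_nonneg {p q : I → ℝ} (hp : p ∈ stdSimplex ℝ I) (hq : IsPosDist q) :
    0 ≤ relEntropy p q := by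
  nlinarith [l1Dist_sq_le hp hq, sq_nonneg (l1Dist p q)]

theorem eq_of_relEntropy_le_zero {p q : I → ℝ} (hp : p ∈ stdSimplex ℝ I) (hq : IsPosDist q)
    (h : relEntropy p q ≤ 0) : p = q := by
  have h0 : l1Dist p q = 0 := by
    have := l1Dist_sq_le hp hq
    exact pow_eq_zero_iff (two_ne_zero) |>.1 (le_antisymm (by linarith) (sq_nonneg _))
  funext i
  have := (sum_eq_zero_iff_of_nonneg fun i _ => abs_nonneg (p i - q i)).1 h0 i (mem_univ i)
  exact sub_eq_zero.1 (abs_eq_zero.1 this)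

theorem isPosDist_uniform [Nonempty I] : IsPosDist (uniform I) where
  pos _ := by unfold uniform; positivity
  sum_eq_one := by simp [uniform]

theorem relEntropy_uniform {p : I → ℝ} (hp : p ∈ stdSimplex ℝ I) :
    relEntropy p (uniform I) = Real.log (Fintype.card I) - entropy p := by
  simp only [relEntropy, uniform, entropy, mul_sub, sum_sub_distrib, ← sum_mul, hp.2, one_div,
    Real.log_inv]
  ring

theorem entropy_nonneg {p : I → ℝ} (hp : p ∈ stdSimplex ℝ I) : 0 ≤ entropy p := by
  rw [entropy, neg_nonneg]
  refine sum_nonpos fun i _ => mul_nonpos_of_nonneg_of_nonpos (hp.1 i) ?_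
  exact Real.log_nonpos (hp.1 i) (hp.2 ▸ single_le_sum (fun j _ => hp.1 j) (mem_univ i))

theorem entropy_le_log_card [Nonempty I] {p : I → ℝ} (hp : p ∈ stdSimplex ℝ I) :
    entropy p ≤ Real.log (Fintype.card I) := by
  linarith [relEntropy_nonneg hp isPosDist_uniform, relEntropy_uniform hp]

theorem continuous_entropy : Continuous (entropy : (I → ℝ) → ℝ) := by
  unfold entropy
  have := Real.continuous_mul_log
  exact (continuous_finsetSum _ fun i _ => this.comp (continuous_apply i)).neg

theorem le_entropy_convexCombination {p q : I → ℝ} (hp : p ∈ stdSimplex ℝ I)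
    (hq : q ∈ stdSimplex ℝ I) {t : ℝ} (h0 : 0 ≤ t) (h1 : t ≤ 1) :
    (1 - t) * entropy p + t * entropy q ≤ entropy ((1 - t) • p + t • q) := by
  simp only [entropy, mul_neg, ← neg_add, neg_le_neg_iff, mul_sum, ← sum_add_distrib]
  refine sum_le_sum fun i _ => ?_
  have := Real.convexOn_mul_log.2 (hp.1 i) (hq.1 i) (by linarith : 0 ≤ 1 - t) h0 (by ring)
  simpa using this

/-- The softmax distribution of `g` at temperature `τ`. -/
noncomputable def gibbs (τ : ℝ) (g : I → ℝ) : I → ℝ :=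
  fun i => Real.exp (g i / τ) / ∑ j, Real.exp (g j / τ)

theorem isPosDist_gibbs [Nonempty I] (τ : ℝ) (g : I → ℝ) : IsPosDist (gibbs τ g) := by
  have h : 0 < ∑ j, Real.exp (g j / τ) := sum_pos (fun _ _ => Real.exp_pos _) univ_nonempty
  exact ⟨fun i => div_pos (Real.exp_pos _) h, by simp only [gibbs, ← sum_div]; exact div_self h.ne'⟩

theorem log_gibbs [Nonempty I] (τ : ℝ) (g : I → ℝ) (i : I) :
    Real.log (gibbs τ g i) = g i / τ - Real.log (∑ j, Real.exp (g j / τ)) := by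
  have h : 0 < ∑ j, Real.exp (g j / τ) := sum_pos (fun _ _ => Real.exp_pos _) univ_nonempty
  rw [gibbs, Real.log_div (Real.exp_pos _).ne' h.ne', Real.log_exp]

/-- The Gibbs variational identity. -/
theorem dotProduct_add_entropy [Nonempty I] {τ : ℝ} (hτ : τ ≠ 0) (g : I → ℝ) {p : I → ℝ}
    (hp : p ∈ stdSimplex ℝ I) :
    dotProduct p g + τ * entropy p =
      τ * Real.log (∑ j, Real.exp (g j / τ)) - τ * relEntropy p (gibbs τ g) := by
  have h : relEntropy p (gibbs τ g) =
      -entropy p - (dotProduct p g) / τ + Real.log (∑ j, Real.exp (g j / τ)) := by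
    simp only [relEntropy, log_gibbs, entropy, dotProduct, mul_sub, sum_sub_distrib, ← sum_mul,
      hp.2, sum_div, mul_div_assoc]
    ring
  rw [h]
  field_simp
  ring

theorem isPosDist_multUpdate [Nonempty I] (η τ : ℝ) {p : I → ℝ} (hp : IsPosDist p)
    (g : I → ℝ) : IsPosDist (multUpdate η τ p g) := by
  have h1 : ∀ j, 0 < p j ^ (1 - η * τ) * Real.exp (η * g j) := fun j =>
    mul_pos (Real.rpow_pos_of_pos (hp.pos j) _) (Real.exp_pos _)
  have h : 0 < ∑ j, p j ^ (1 - η * τ) * Real.exp (η * g j) :=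
    sum_pos (fun j _ => h1 j) univ_nonempty
  exact ⟨fun i => div_pos (h1 i) h, by
    simp only [multUpdate, ← sum_div]; exact div_self h.ne'⟩

/-- In logarithms the update is affine up to a normalizing constant, which disappears when summed
against a difference of probability vectors. -/
theorem exists_log_multUpdate [Nonempty I] (η τ : ℝ) {p : I → ℝ} (hp : IsPosDist p)
    (g : I → ℝ) :
    ∃ c, ∀ i, Real.log (multUpdate η τ p g i) = (1 - η * τ) * Real.log (p i) + η * g i + c := by
  have h1 : ∀ j, 0 < p j ^ (1 - η * τ) * Real.exp (η * g j) := fun j =>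
    mul_pos (Real.rpow_pos_of_pos (hp.pos j) _) (Real.exp_pos _)
  have h : 0 < ∑ j, p j ^ (1 - η * τ) * Real.exp (η * g j) :=
    sum_pos (fun j _ => h1 j) univ_nonempty
  refine ⟨-Real.log (∑ j, p j ^ (1 - η * τ) * Real.exp (η * g j)), fun i => ?_⟩
  rw [multUpdate, Real.log_div (h1 i).ne' h.ne',
    Real.log_mul (Real.rpow_pos_of_pos (hp.pos i) _).ne' (Real.exp_pos _).ne',
    Real.log_rpow (hp.pos i), Real.log_exp]
  ring

end RelativeEntropy

/-! ### Saddle points of regularized matrix games. -/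

section MatrixGameEquilibrium

variable {A B : Type*} [Fintype A] [Fintype B]

/-- A saddle point of the entropy-regularized matrix game over the simplices. -/
structure IsSaddle (τ : ℝ) (Q : Matrix A B ℝ) (μ : A → ℝ) (ν : B → ℝ) : Prop where
  left_mem : μ ∈ stdSimplex ℝ A
  right_mem : ν ∈ stdSimplex ℝ B
  le_left : ∀ μ' ∈ stdSimplex ℝ A, regPayoff τ Q μ' ν ≤ regPayoff τ Q μ ν
  le_right : ∀ ν' ∈ stdSimplex ℝ B, regPayoff τ Q μ ν ≤ regPayoff τ Q μ ν'

theorem dotProduct_mulVec_transpose (Q : Matrix A B ℝ) (μ : A → ℝ) (ν : B → ℝ) :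
    dotProduct μ (Q.mulVec ν) = dotProduct ν (Q.transpose.mulVec μ) := by
  rw [Matrix.dotProduct_mulVec, ← Matrix.mulVec_transpose, dotProduct_comm]

/-- Only the last term depends on `μ`, so for `τ > 0` the Gibbs distribution is the unique best
response and the loss of any other response is a relative entropy. -/
theorem regPayoff_eq_relEntropy_left [Nonempty A] {τ : ℝ} (hτ : τ ≠ 0) (Q : Matrix A B ℝ)
    {μ : A → ℝ} (hμ : μ ∈ stdSimplex ℝ A) (ν : B → ℝ) :
    regPayoff τ Q μ ν = τ * Real.log (∑ a, Real.exp (Q.mulVec ν a / τ)) - τ * entropy ν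
      - τ * relEntropy μ (gibbs τ (Q.mulVec ν)) := by
  rw [regPayoff, dotProduct_add_entropy hτ _ hμ]
  ring

theorem regPayoff_eq_relEntropy_right [Nonempty B] {τ : ℝ} (hτ : τ ≠ 0) (Q : Matrix A B ℝ)
    (μ : A → ℝ) {ν : B → ℝ} (hν : ν ∈ stdSimplex ℝ B) :
    regPayoff τ Q μ ν = τ * entropy μ
      - τ * Real.log (∑ b, Real.exp ((-(Q.transpose.mulVec μ)) b / τ))
      + τ * relEntropy ν (gibbs τ (-(Q.transpose.mulVec μ))) := by
  have h := dotProduct_add_entropy hτ (-(Q.transpose.mulVec μ)) hν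
  rw [dotProduct_neg, ← dotProduct_mulVec_transpose] at h
  rw [regPayoff]
  linarith

theorem continuous_gibbs {I : Type*} [Fintype I] [Nonempty I] (τ : ℝ) :
    Continuous (gibbs τ : (I → ℝ) → I → ℝ) := by
  unfold gibbs
  refine continuous_pi fun i => Continuous.div (by fun_prop) (by fun_prop) fun g => ?_
  exact (sum_pos (fun _ _ => Real.exp_pos _) univ_nonempty).ne'

theorem continuous_regPayoff (τ : ℝ) (Q : Matrix A B ℝ) :
    Continuous fun x : (A → ℝ) × (B → ℝ) => regPayoff τ Q x.1 x.2 := by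
  unfold regPayoff
  have h1 : Continuous fun x : (A → ℝ) × (B → ℝ) => entropy x.1 :=
    continuous_entropy.comp continuous_fst
  have h2 : Continuous fun x : (A → ℝ) × (B → ℝ) => entropy x.2 :=
    continuous_entropy.comp continuous_snd
  have h3 : Continuous fun x : (A → ℝ) × (B → ℝ) => dotProduct x.1 (Q.mulVec x.2) := by
    simp only [dotProduct, Matrix.mulVec]
    fun_prop
  fun_prop

theorem regPayoff_concave_left {τ : ℝ} (hτ : 0 ≤ τ) (Q : Matrix A B ℝ) {p q : A → ℝ}
    (hp : p ∈ stdSimplex ℝ A) (hq : q ∈ stdSimplex ℝ A) (ν : B → ℝ) {t : ℝ} (h0 : 0 ≤ t)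
    (h1 : t ≤ 1) :
    (1 - t) * regPayoff τ Q p ν + t * regPayoff τ Q q ν ≤
      regPayoff τ Q ((1 - t) • p + t • q) ν := by
  have h := mul_le_mul_of_nonneg_left (le_entropy_convexCombination hp hq h0 h1) hτ
  simp only [regPayoff, add_dotProduct, smul_dotProduct, smul_eq_mul]
  linarith

/-- Every entropy-regularized matrix game has a saddle point. -/
theorem exists_isSaddle [Nonempty A] [Nonempty B] {τ : ℝ} (hτ : 0 < τ) (Q : Matrix A B ℝ) :
    ∃ μ ν, IsSaddle τ Q μ ν := by
  set br : (A → ℝ) → B → ℝ := fun μ => gibbs τ (-(Q.transpose.mulVec μ)) with hbr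
  have hbr_cont : Continuous br := by
    refine (continuous_gibbs τ).comp ?_
    unfold Matrix.mulVec dotProduct
    fun_prop
  have hbr_mem : ∀ μ, br μ ∈ stdSimplex ℝ B := fun μ => (isPosDist_gibbs _ _).mem_stdSimplex
  have hbr_le : ∀ μ, ∀ ν ∈ stdSimplex ℝ B, regPayoff τ Q μ (br μ) ≤ regPayoff τ Q μ ν := by
    intro μ ν hν
    rw [regPayoff_eq_relEntropy_right hτ.ne' Q μ hν,
      regPayoff_eq_relEntropy_right hτ.ne' Q μ (hbr_mem μ), relEntropy_self]
    have := mul_nonneg hτ.le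
      (relEntropy_nonneg hν (isPosDist_gibbs τ (-(Q.transpose.mulVec μ))))
    linarith
  -- `μ` maximizes the worst-case payoff, which is continuous because the best response `br` is.
  obtain ⟨μ, hμ, hmax⟩ := (isCompact_stdSimplex ℝ A).exists_isMaxOn
    ⟨uniform A, isPosDist_uniform.mem_stdSimplex⟩
    ((continuous_regPayoff τ Q).comp (continuous_id.prodMk hbr_cont)).continuousOn
  refine ⟨μ, br μ, hμ, hbr_mem μ, fun μ' hμ' => ?_, hbr_le μ⟩
  -- Danskin's argument: for `μ_t = (1 - t) • μ + t • μ'`, concavity and maximality of `μ` show that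
  -- `μ'` against `br μ_t` earns at most the payoff of `(μ, br μ)`. Letting `t` tend to `0` replaces
  -- `br μ_t` by `br μ`.
  have hlim : Tendsto (fun t : ℝ => regPayoff τ Q μ' (br ((1 - t) • μ + t • μ'))) (𝓝[>] 0)
      (𝓝 (regPayoff τ Q μ' (br μ))) := by
    have hc : Continuous fun t : ℝ => regPayoff τ Q μ' (br ((1 - t) • μ + t • μ')) :=
      (continuous_regPayoff τ Q).comp (continuous_const.prodMk (hbr_cont.comp (by fun_prop)))
    have := hc.tendsto 0
    simp only [sub_zero, one_smul, zero_smul, add_zero] at this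
    exact this.mono_left nhdsWithin_le_nhds
  refine le_of_tendsto hlim ?_
  filter_upwards [Ioo_mem_nhdsGT (zero_lt_one' ℝ)] with t ht
  have hmem : (1 - t) • μ + t • μ' ∈ stdSimplex ℝ A :=
    convex_stdSimplex ℝ A hμ hμ' (by linarith [ht.2]) ht.1.le (by ring)
  have h1 := isMaxOn_iff.1 hmax _ hmem
  simp only [Function.comp_apply, id] at h1
  have h2 := regPayoff_concave_left hτ.le Q hμ hμ' (br ((1 - t) • μ + t • μ')) ht.1.le ht.2.le
  have h3 := mul_le_mul_of_nonneg_left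
    (hbr_le μ _ (hbr_mem ((1 - t) • μ + t • μ'))) (by linarith [ht.2] : 0 ≤ 1 - t)
  have h4 : t * regPayoff τ Q μ' (br ((1 - t) • μ + t • μ')) ≤ t * regPayoff τ Q μ (br μ) := by
    linarith
  exact le_of_mul_le_mul_left h4 ht.1

/-- Testing the saddle inequality against the Gibbs response forces the relative entropy of `μ` to
it to be nonpositive. -/
theorem IsSaddle.left_eq_gibbs [Nonempty A] {τ : ℝ} (hτ : 0 < τ) {Q : Matrix A B ℝ}
    {μ : A → ℝ} {ν : B → ℝ} (h : IsSaddle τ Q μ ν) : μ = gibbs τ (Q.mulVec ν) := by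
  have hg := isPosDist_gibbs τ (Q.mulVec ν)
  refine eq_of_relEntropy_le_zero h.left_mem hg ?_
  have h1 := h.le_left _ hg.mem_stdSimplex
  rw [regPayoff_eq_relEntropy_left hτ.ne' Q hg.mem_stdSimplex,
    regPayoff_eq_relEntropy_left hτ.ne' Q h.left_mem, relEntropy_self] at h1
  exact nonpos_of_mul_nonpos_right (by linarith : τ * _ ≤ 0) hτ

theorem IsSaddle.right_eq_gibbs [Nonempty B] {τ : ℝ} (hτ : 0 < τ) {Q : Matrix A B ℝ}
    {μ : A → ℝ} {ν : B → ℝ} (h : IsSaddle τ Q μ ν) :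
    ν = gibbs τ (-(Q.transpose.mulVec μ)) := by
  have hg := isPosDist_gibbs τ (-(Q.transpose.mulVec μ))
  refine eq_of_relEntropy_le_zero h.right_mem hg ?_
  have h1 := h.le_right _ hg.mem_stdSimplex
  rw [regPayoff_eq_relEntropy_right hτ.ne' Q μ hg.mem_stdSimplex,
    regPayoff_eq_relEntropy_right hτ.ne' Q μ h.right_mem, relEntropy_self] at h1
  exact nonpos_of_mul_nonpos_right (by linarith : τ * _ ≤ 0) hτ

theorem abs_dotProduct_mulVec_le {Q : Matrix A B ℝ} {q : ℝ} (hQ : ∀ a b, |Q a b| ≤ q)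
    (u : A → ℝ) (v : B → ℝ) :
    |dotProduct u (Q.mulVec v)| ≤ q * ((∑ a, |u a|) * ∑ b, |v b|) := by
  calc |dotProduct u (Q.mulVec v)| = |∑ a, ∑ b, u a * (Q a b * v b)| := by
        simp only [dotProduct, Matrix.mulVec, mul_sum]
    _ ≤ ∑ a, ∑ b, |u a * (Q a b * v b)| :=
        (abs_sum_le_sum_abs _ _).trans (sum_le_sum fun a _ => abs_sum_le_sum_abs _ _)
    _ ≤ ∑ a, ∑ b, q * (|u a| * |v b|) := by
        refine sum_le_sum fun a _ => sum_le_sum fun b _ => ?_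
        rw [abs_mul, abs_mul]
        have := mul_le_mul_of_nonneg_right (hQ a b) (mul_nonneg (abs_nonneg (u a))
          (abs_nonneg (v b)))
        linarith
    _ = q * ((∑ a, |u a|) * ∑ b, |v b|) := by
        rw [sum_mul_sum]
        simp only [mul_sum]

theorem abs_dotProduct_mulVec_le_of_mem {Q : Matrix A B ℝ} {q : ℝ} (hQ : ∀ a b, |Q a b| ≤ q)
    {μ : A → ℝ} {ν : B → ℝ} (hμ : μ ∈ stdSimplex ℝ A) (hν : ν ∈ stdSimplex ℝ B) :
    |dotProduct μ (Q.mulVec ν)| ≤ q := by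
  have h := abs_dotProduct_mulVec_le hQ μ ν
  simpa [abs_of_nonneg (hμ.1 _), abs_of_nonneg (hν.1 _), hμ.2, hν.2] using h

/-- The two entropies enter with opposite signs and both lie between `0` and `log |A|`, so only one
copy of `τ * log |A|` is lost. -/
theorem abs_regPayoff_le [Nonempty A] [Nonempty B] {τ : ℝ} (hτ : 0 ≤ τ) {Q : Matrix A B ℝ}
    {q : ℝ} (hQ : ∀ a b, |Q a b| ≤ q) (hcard : Fintype.card B ≤ Fintype.card A)
    {μ : A → ℝ} {ν : B → ℝ} (hμ : μ ∈ stdSimplex ℝ A) (hν : ν ∈ stdSimplex ℝ B) :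
    |regPayoff τ Q μ ν| ≤ q + τ * Real.log (Fintype.card A) := by
  have h1 := abs_le.1 (abs_dotProduct_mulVec_le_of_mem hQ hμ hν)
  have h2 := mul_le_mul_of_nonneg_left (entropy_le_log_card hμ) hτ
  have hlog : Real.log (Fintype.card B) ≤ Real.log (Fintype.card A) :=
    Real.log_le_log (by positivity) (by exact_mod_cast hcard)
  have h3 := mul_le_mul_of_nonneg_left ((entropy_le_log_card hν).trans hlog) hτ
  have h4 := mul_nonneg hτ (entropy_nonneg hμ)
  have h5 := mul_nonneg hτ (entropy_nonneg hν)
  rw [regPayoff, abs_le]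
  constructor <;> linarith

theorem regPayoff_sub_regPayoff (τ : ℝ) (Q Q' : Matrix A B ℝ) (μ : A → ℝ) (ν : B → ℝ) :
    regPayoff τ Q μ ν - regPayoff τ Q' μ ν = dotProduct μ ((Q - Q').mulVec ν) := by
  rw [regPayoff, regPayoff, Matrix.sub_mulVec, dotProduct_sub]
  ring

theorem abs_regPayoff_sub_le (τ : ℝ) {Q Q' : Matrix A B ℝ} {c : ℝ}
    (h : ∀ a b, |Q a b - Q' a b| ≤ c) {μ : A → ℝ} {ν : B → ℝ} (hμ : μ ∈ stdSimplex ℝ A)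
    (hν : ν ∈ stdSimplex ℝ B) : |regPayoff τ Q μ ν - regPayoff τ Q' μ ν| ≤ c := by
  rw [regPayoff_sub_regPayoff]
  exact abs_dotProduct_mulVec_le_of_mem h hμ hν

theorem regPayoff_sub_le (τ : ℝ) {Q Q' : Matrix A B ℝ} {c : ℝ}
    (h : ∀ a b, Q a b - Q' a b ≤ c) {μ : A → ℝ} {ν : B → ℝ} (hμ : μ ∈ stdSimplex ℝ A)
    (hν : ν ∈ stdSimplex ℝ B) : regPayoff τ Q μ ν - regPayoff τ Q' μ ν ≤ c := by
  rw [regPayoff_sub_regPayoff]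
  calc dotProduct μ ((Q - Q').mulVec ν) ≤ ∑ a, μ a * c := by
        refine sum_le_sum fun a _ => mul_le_mul_of_nonneg_left ?_ (hμ.1 a)
        calc (Q - Q').mulVec ν a ≤ ∑ b, c * ν b :=
              sum_le_sum fun b _ => mul_le_mul_of_nonneg_right (h a b) (hν.1 b)
          _ = c := by rw [← mul_sum, hν.2, mul_one]
    _ = c := by rw [← sum_mul, hμ.2, one_mul]

/-- The saddle value is a nonexpansive function of the payoff matrix. -/
theorem IsSaddle.abs_regPayoff_sub_le {τ : ℝ} {Q Q' : Matrix A B ℝ} {μ μ' : A → ℝ}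
    {ν ν' : B → ℝ} (h : IsSaddle τ Q μ ν) (h' : IsSaddle τ Q' μ' ν') {c : ℝ}
    (hc : ∀ a b, |Q a b - Q' a b| ≤ c) : |regPayoff τ Q μ ν - regPayoff τ Q' μ' ν'| ≤ c := by
  -- Both saddle values are compared at the crossed pairs `(μ, ν')` and `(μ', ν)`, where only the
  -- matrix changes.
  have h1 := h.le_right _ h'.right_mem
  have h2 := h'.le_left _ h.left_mem
  have h3 := h.le_left _ h'.left_mem
  have h4 := h'.le_right _ h.right_mem
  have h5 := abs_le.1 (EntropyGame.abs_regPayoff_sub_le τ hc h.left_mem h'.right_mem)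
  have h6 := abs_le.1 (EntropyGame.abs_regPayoff_sub_le τ hc h'.left_mem h.right_mem)
  rw [abs_le]
  constructor <;> linarith [h5.1, h5.2, h6.1, h6.2]

end MatrixGameEquilibrium

/-! ### One-step estimates for multiplicative updates. -/

section MultiplicativeUpdates

variable {I : Type*} [Fintype I]

/-- Relative entropies to `ps` before and after an update in direction `g` that is evaluated at
`pbar`. -/
theorem relEntropy_update_eq {η τ c c' : ℝ} {p p' pbar ps g gs : I → ℝ}
    (hlog : ∀ i, Real.log (p' i) = (1 - η * τ) * Real.log (p i) + η * g i + c)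
    (hs : ∀ i, τ * Real.log (ps i) = gs i + c')
    (hbar : ∑ i, pbar i = 1) (hps : ∑ i, ps i = 1) :
    relEntropy ps p' = (1 - η * τ) * relEntropy ps p - (1 - η * τ) * relEntropy pbar p
      - η * τ * relEntropy pbar ps + relEntropy pbar p'
      + η * dotProduct (pbar - ps) (g - gs) := by
  rw [← sub_eq_zero]
  -- Both normalizing constants drop out because `ps` and `pbar` have equal mass; the rest is a
  -- termwise identity.
  have h0 : ∑ i, (ps i - pbar i) * (η * c' - c) = 0 := by
    rw [← sum_mul, sum_sub_distrib, hbar, hps]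
    ring
  rw [← h0]
  simp only [relEntropy, dotProduct, mul_sum, ← sum_add_distrib, ← sum_sub_distrib]
  refine sum_congr rfl fun i _ => ?_
  simp only [Pi.sub_apply]
  linear_combination (ps i - pbar i) * (η * hs i - hlog i)

/-- Both updates start from `p`, so the symmetrized divergence is `η` times the pairing of `r - r'`
with `g - g'`, hence at most `η * m * d` with `d` the `ℓ¹` distance. Pinsker removes `d ^ 2 / 2` for
the reverse divergence, and `η * m * d - d ^ 2 / 2 ≤ (η * m) ^ 2 / 2`. -/
theorem relEntropy_multUpdate_le [Nonempty I] {η τ m : ℝ} (hη : 0 ≤ η) {p : I → ℝ}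
    (hp : IsPosDist p) (g g' : I → ℝ)
    (h : ∀ u : I → ℝ, |dotProduct u (g - g')| ≤ m * ∑ i, |u i|) :
    relEntropy (multUpdate η τ p g) (multUpdate η τ p g') ≤ (η * m) ^ 2 / 2 := by
  have h1 := isPosDist_multUpdate η τ hp g
  have h2 := isPosDist_multUpdate η τ hp g'
  obtain ⟨c, hc⟩ := exists_log_multUpdate η τ hp g
  obtain ⟨c', hc'⟩ := exists_log_multUpdate η τ hp g'
  set r := multUpdate η τ p g
  set r' := multUpdate η τ p g'
  have hsum : relEntropy r r' + relEntropy r' r = η * dotProduct (r - r') (g - g') := by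
    rw [← sub_eq_zero]
    have h0 : ∑ i, (r i - r' i) * (c - c') = 0 := by
      rw [← sum_mul, sum_sub_distrib, h1.sum_eq_one, h2.sum_eq_one]
      ring
    rw [← h0]
    simp only [relEntropy, dotProduct, mul_sum, ← sum_add_distrib, ← sum_sub_distrib]
    refine sum_congr rfl fun i _ => ?_
    simp only [Pi.sub_apply, hc, hc']
    ring
  have h3 := mul_le_mul_of_nonneg_left ((abs_le.1 (h (r - r'))).2) hη
  have h4 := l1Dist_sq_le h2.mem_stdSimplex h1
  rw [l1Dist_comm] at h4
  have h5 : ∑ i, |(r - r') i| = l1Dist r r' := rfl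
  rw [h5] at h3
  nlinarith [sq_nonneg (l1Dist r r' - η * m)]

end MultiplicativeUpdates

/-! ### Linear convergence of PU and OMWU. -/

section InnerConvergence

variable {A B : Type*} [Fintype A] [Fintype B]

/-- All four components of an iterate are probability vectors with full support. -/
structure Iterate.IsPos (x : Iterate A B) : Prop where
  μ : IsPosDist x.μ
  ν : IsPosDist x.ν
  μbar : IsPosDist x.μbar
  νbar : IsPosDist x.νbar

/-- The relative entropy of the midpoints to the policies. -/
noncomputable def Iterate.midGap (x : Iterate A B) : ℝ :=
  relEntropy x.μbar x.μ + relEntropy x.νbar x.ν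

/-- The Lyapunov function of the two methods. -/
noncomputable def Iterate.potential (μs : A → ℝ) (νs : B → ℝ) (x : Iterate A B) : ℝ :=
  relEntropy μs x.μ + relEntropy νs x.ν + x.midGap

theorem Method.run_succ (m : Method) (η τ : ℝ) (Q : Matrix A B ℝ) (T : ℕ) :
    m.run η τ Q (T + 1) = m.step η τ Q (m.run η τ Q T) :=
  Function.iterate_succ_apply' _ _ _

theorem Iterate.midGap_nonneg {x : Iterate A B} (hx : x.IsPos) : 0 ≤ x.midGap :=
  add_nonneg (relEntropy_nonneg hx.μbar.mem_stdSimplex hx.μ)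
    (relEntropy_nonneg hx.νbar.mem_stdSimplex hx.ν)

theorem Iterate.potential_nonneg {μs : A → ℝ} {νs : B → ℝ} (hμ : μs ∈ stdSimplex ℝ A)
    (hν : νs ∈ stdSimplex ℝ B) {x : Iterate A B} (hx : x.IsPos) : 0 ≤ x.potential μs νs :=
  add_nonneg (add_nonneg (relEntropy_nonneg hμ hx.μ) (relEntropy_nonneg hν hx.ν))
    (x.midGap_nonneg hx)

theorem l1Dist_sq_le_of_triangle {I : Type*} [Fintype I] {p q r : I → ℝ} (hp : IsPosDist p)
    (hq : IsPosDist q) (hr : IsPosDist r) :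
    l1Dist p r ^ 2 ≤ 4 * (relEntropy p q + relEntropy r q) := by
  have h1 := l1Dist_triangle p q r
  have h2 := l1Dist_sq_le hp.mem_stdSimplex hq
  have h3 := l1Dist_sq_le hr.mem_stdSimplex hq
  rw [l1Dist_comm] at h3
  have h4 : l1Dist p r ^ 2 ≤ (l1Dist p q + l1Dist q r) ^ 2 :=
    pow_le_pow_left₀ (l1Dist_nonneg _ _) h1 2
  nlinarith [sq_nonneg (l1Dist p q - l1Dist q r)]

/-- The only place where the two methods are distinguished. PU predicts with `x.μ` itself; OMWU
predicts with the old midpoint, whose distance to `x.μ` is paid for by `x.midGap`. -/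
theorem Method.prediction_sq_le (m : Method) {x : Iterate A B} (hx : x.IsPos) {μ : A → ℝ}
    {ν : B → ℝ} (hμ : IsPosDist μ) (hν : IsPosDist ν) :
    l1Dist μ (m.prediction x).1 ^ 2 + l1Dist ν (m.prediction x).2 ^ 2 ≤
      4 * (relEntropy μ x.μ + relEntropy ν x.ν + x.midGap) := by
  unfold Iterate.midGap
  cases m with
  | PU =>
    have h1 := l1Dist_sq_le_of_triangle hμ hx.μ hx.μ
    have h2 := l1Dist_sq_le_of_triangle hν hx.ν hx.ν
    have h3 := x.midGap_nonneg hx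
    rw [relEntropy_self] at h1 h2
    unfold Iterate.midGap at h3
    simp only [Method.prediction]
    linarith
  | OMWU =>
    have h1 := l1Dist_sq_le_of_triangle hμ hx.μ hx.μbar
    have h2 := l1Dist_sq_le_of_triangle hν hx.ν hx.νbar
    simp only [Method.prediction]
    linarith

theorem IsSaddle.isPosDist_left [Nonempty A] {τ : ℝ} (hτ : 0 < τ) {Q : Matrix A B ℝ} {μs : A → ℝ}
    {νs : B → ℝ} (h : IsSaddle τ Q μs νs) : IsPosDist μs := by
  rw [h.left_eq_gibbs hτ]
  exact isPosDist_gibbs _ _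

theorem IsSaddle.isPosDist_right [Nonempty B] {τ : ℝ} (hτ : 0 < τ) {Q : Matrix A B ℝ} {μs : A → ℝ}
    {νs : B → ℝ} (h : IsSaddle τ Q μs νs) : IsPosDist νs := by
  rw [h.right_eq_gibbs hτ]
  exact isPosDist_gibbs _ _

theorem Iterate.potential_init_le [Nonempty B] (hcard : Fintype.card B ≤ Fintype.card A) {μs : A → ℝ}
    {νs : B → ℝ} (hμ : μs ∈ stdSimplex ℝ A) (hν : νs ∈ stdSimplex ℝ B) :
    (Iterate.init A B).potential μs νs ≤ 2 * Real.log (Fintype.card A) := by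
  have hlog : Real.log (Fintype.card B) ≤ Real.log (Fintype.card A) :=
    Real.log_le_log (by positivity) (by exact_mod_cast hcard)
  have h1 := relEntropy_uniform hμ
  have h2 := relEntropy_uniform hν
  have h3 := entropy_nonneg hμ
  have h4 := entropy_nonneg hν
  simp only [Iterate.potential, Iterate.midGap, Iterate.init, relEntropy_self]
  linarith

variable [Nonempty A] [Nonempty B]

theorem Iterate.isPos_init : (Iterate.init A B).IsPos :=
  ⟨isPosDist_uniform, isPosDist_uniform, isPosDist_uniform, isPosDist_uniform⟩

theorem Method.isPos_step (m : Method) (η τ : ℝ) (Q : Matrix A B ℝ) {x : Iterate A B}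
    (hx : x.IsPos) : (m.step η τ Q x).IsPos :=
  ⟨isPosDist_multUpdate _ _ hx.μ _, isPosDist_multUpdate _ _ hx.ν _,
    isPosDist_multUpdate _ _ hx.μ _, isPosDist_multUpdate _ _ hx.ν _⟩

theorem Method.isPos_run (m : Method) (η τ : ℝ) (Q : Matrix A B ℝ) (T : ℕ) :
    (m.run η τ Q T).IsPos := by
  induction T with
  | zero => exact Iterate.isPos_init
  | succ T ih => rw [Method.run_succ]; exact m.isPos_step η τ Q ih

/-- Midpoint and new policy are updates of the same policy, in directions that differ by `Q` applied
to the prediction error. The constant is `1 / 2` from `relEntropy_multUpdate_le` times `4` from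
`Method.prediction_sq_le`. -/
theorem Method.midGap_step_le (m : Method) {η τ q : ℝ} (hη : 0 ≤ η) {Q : Matrix A B ℝ}
    (hQ : ∀ a b, |Q a b| ≤ q) {x : Iterate A B} (hx : x.IsPos) :
    (m.step η τ Q x).midGap ≤ 2 * (η * q) ^ 2 *
      (relEntropy (m.step η τ Q x).μbar x.μ + relEntropy (m.step η τ Q x).νbar x.ν
        + x.midGap) := by
  have hy := m.isPos_step η τ Q hx
  have hpred := m.prediction_sq_le hx hy.μbar hy.νbar
  set y := m.step η τ Q x with hydef
  have h1 : relEntropy y.μbar y.μ ≤ (η * (q * l1Dist y.νbar (m.prediction x).2)) ^ 2 / 2 := by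
    refine relEntropy_multUpdate_le hη hx.μ _ _ fun u => ?_
    have := abs_dotProduct_mulVec_le hQ u ((m.prediction x).2 - y.νbar)
    rw [Matrix.mulVec_sub] at this
    refine this.trans_eq ?_
    rw [l1Dist_comm, l1Dist]
    simp only [Pi.sub_apply]
    ring
  have h2 : relEntropy y.νbar y.ν ≤ (η * (q * l1Dist y.μbar (m.prediction x).1)) ^ 2 / 2 := by
    refine relEntropy_multUpdate_le hη hx.ν _ _ fun u => ?_
    have := abs_dotProduct_mulVec_le (Q := Q.transpose) (fun a b => hQ b a) u
      (y.μbar - (m.prediction x).1)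
    rw [Matrix.mulVec_sub] at this
    rw [neg_sub_neg]
    refine this.trans_eq ?_
    rw [l1Dist]
    simp only [Pi.sub_apply]
    ring
  have h3 := mul_le_mul_of_nonneg_left hpred (by positivity : 0 ≤ (η * q) ^ 2 / 2)
  unfold Iterate.midGap at h3 ⊢
  nlinarith

theorem exists_mul_log_gibbs {I : Type*} [Fintype I] [Nonempty I] {τ : ℝ} (hτ : 0 < τ)
    {g p : I → ℝ} (h : p = gibbs τ g) : ∃ c, ∀ i, τ * Real.log (p i) = g i + c := by
  refine ⟨-(τ * Real.log (∑ j, Real.exp (g j / τ))), fun i => ?_⟩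
  rw [h, log_gibbs]
  field_simp
  ring

/-- The potential contracts with factor `1 - η τ`, with a surplus that controls the reverse relative
entropy of the midpoints. -/
theorem Method.potential_step_le (m : Method) {η τ q : ℝ} (hη : 0 ≤ η) (hτ : 0 < τ)
    (hηq : η * (2 * q + τ) ≤ 1) {Q : Matrix A B ℝ} (hQ : ∀ a b, |Q a b| ≤ q)
    {μs : A → ℝ} {νs : B → ℝ} (hs : IsSaddle τ Q μs νs) {x : Iterate A B} (hx : x.IsPos) :
    (m.step η τ Q x).potential μs νs + η * τ *
      (relEntropy (m.step η τ Q x).μbar μs + relEntropy (m.step η τ Q x).νbar νs) ≤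
      (1 - η * τ) * x.potential μs νs := by
  have hq : 0 ≤ q := (abs_nonneg _).trans (hQ (Classical.arbitrary A) (Classical.arbitrary B))
  have hy := m.isPos_step η τ Q hx
  have hgap := m.midGap_step_le (τ := τ) hη hQ hx
  have hxgap := x.midGap_nonneg hx
  obtain ⟨c₁, hc₁⟩ := exists_log_multUpdate η τ hx.μ (Q.mulVec (m.step η τ Q x).νbar)
  obtain ⟨c₂, hc₂⟩ := exists_log_multUpdate η τ hx.ν
    (-(Q.transpose.mulVec (m.step η τ Q x).μbar))
  obtain ⟨d₁, hd₁⟩ := exists_mul_log_gibbs hτ (hs.left_eq_gibbs hτ)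
  obtain ⟨d₂, hd₂⟩ := exists_mul_log_gibbs hτ (hs.right_eq_gibbs hτ)
  have h1 := relEntropy_update_eq hc₁ hd₁ hy.μbar.sum_eq_one hs.left_mem.2
  have h2 := relEntropy_update_eq hc₂ hd₂ hy.νbar.sum_eq_one hs.right_mem.2
  change relEntropy μs (m.step η τ Q x).μ = _ + relEntropy _ (m.step η τ Q x).μ + _ at h1
  change relEntropy νs (m.step η τ Q x).ν = _ + relEntropy _ (m.step η τ Q x).ν + _ at h2
  set y := m.step η τ Q x
  -- Zero-sum structure: the bilinear terms of the two players are negatives of each other.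
  have hcross : dotProduct (y.μbar - μs) (Q.mulVec y.νbar - Q.mulVec νs) +
      dotProduct (y.νbar - νs)
        (-(Q.transpose.mulVec y.μbar) - -(Q.transpose.mulVec μs)) = 0 := by
    rw [← Matrix.mulVec_sub, dotProduct_mulVec_transpose, neg_sub_neg, ← Matrix.mulVec_sub,
      ← dotProduct_add, ← Matrix.mulVec_add]
    simp
  have hK : 0 ≤ relEntropy y.μbar x.μ + relEntropy y.νbar x.ν :=
    add_nonneg (relEntropy_nonneg hy.μbar.mem_stdSimplex hx.μ)
      (relEntropy_nonneg hy.νbar.mem_stdSimplex hx.ν)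
  -- The new gap occurs twice, once in the three-point identities and once in the potential, which
  -- doubles the constant `2` of `Method.midGap_step_le`. The bound follows from `2 * η * q ≤ 1 - η
  -- * τ ≤ 1`.
  have hcoef : 4 * (η * q) ^ 2 ≤ 1 - η * τ := by
    have h3 : 0 ≤ η * q := mul_nonneg hη hq
    have h4 : 0 ≤ η * τ := mul_nonneg hη hτ.le
    nlinarith
  have h5 := mul_le_mul_of_nonneg_right hcoef (add_nonneg hK hxgap)
  unfold Iterate.potential
  have h6 : y.midGap = relEntropy y.μbar y.μ + relEntropy y.νbar y.ν := rfl
  have h7 : η * dotProduct (y.μbar - μs) (Q.mulVec y.νbar - Q.mulVec νs) +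
      η * dotProduct (y.νbar - νs)
        (-(Q.transpose.mulVec y.μbar) - -(Q.transpose.mulVec μs)) = 0 := by
    rw [← mul_add, hcross, mul_zero]
  linarith

theorem Method.potential_run_le (m : Method) {η τ q : ℝ} (hη : 0 ≤ η) (hτ : 0 < τ)
    (hηq : η * (2 * q + τ) ≤ 1) {Q : Matrix A B ℝ} (hQ : ∀ a b, |Q a b| ≤ q)
    (hcard : Fintype.card B ≤ Fintype.card A) {μs : A → ℝ} {νs : B → ℝ}
    (hs : IsSaddle τ Q μs νs) (T : ℕ) :
    (m.run η τ Q T).potential μs νs ≤ (1 - η * τ) ^ T * (2 * Real.log (Fintype.card A)) := by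
  have hq : 0 ≤ q := (abs_nonneg _).trans (hQ (Classical.arbitrary A) (Classical.arbitrary B))
  have hρ : 0 ≤ 1 - η * τ := by nlinarith [mul_nonneg hη hq]
  induction T with
  | zero =>
    rw [pow_zero, one_mul]
    exact Iterate.potential_init_le hcard hs.left_mem hs.right_mem
  | succ T ih =>
    have hx := m.isPos_run η τ Q T
    have h1 := m.potential_step_le hη hτ hηq hQ hs hx
    have hy := m.isPos_step η τ Q hx
    have h2 := mul_nonneg (mul_nonneg hη hτ.le)
      (add_nonneg (relEntropy_nonneg hy.μbar.mem_stdSimplex (hs.isPosDist_left hτ))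
        (relEntropy_nonneg hy.νbar.mem_stdSimplex (hs.isPosDist_right hτ)))
    have h3 := mul_le_mul_of_nonneg_left ih hρ
    rw [Method.run_succ, pow_succ']
    linarith

/-- The regularized payoff around a saddle point. -/
theorem IsSaddle.regPayoff_eq {τ : ℝ} (hτ : 0 < τ) {Q : Matrix A B ℝ} {μs : A → ℝ}
    {νs : B → ℝ} (hs : IsSaddle τ Q μs νs) {μ : A → ℝ} {ν : B → ℝ}
    (hμ : μ ∈ stdSimplex ℝ A) (hν : ν ∈ stdSimplex ℝ B) :
    regPayoff τ Q μ ν = regPayoff τ Q μs νs + dotProduct (μ - μs) (Q.mulVec (ν - νs))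
      - τ * relEntropy μ μs + τ * relEntropy ν νs := by
  have h1 := regPayoff_eq_relEntropy_left hτ.ne' Q hμ νs
  have h2 := regPayoff_eq_relEntropy_left hτ.ne' Q hs.left_mem νs
  have h3 := regPayoff_eq_relEntropy_right hτ.ne' Q μs hν
  have h4 := regPayoff_eq_relEntropy_right hτ.ne' Q μs hs.right_mem
  rw [← hs.left_eq_gibbs hτ] at h1 h2
  rw [← hs.right_eq_gibbs hτ] at h3 h4
  rw [relEntropy_self] at h2 h4
  -- The entropies are separable, so the mixed second difference is purely bilinear.
  have h5 : regPayoff τ Q μ ν - regPayoff τ Q μ νs - regPayoff τ Q μs ν + regPayoff τ Q μs νs =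
      dotProduct (μ - μs) (Q.mulVec (ν - νs)) := by
    simp only [regPayoff, Matrix.mulVec_sub, dotProduct_sub, sub_dotProduct]
    ring
  linarith

/-- The value gap of the last midpoint decays linearly with a factor free of `1 / τ`. -/
theorem Method.abs_regPayoff_run_sub_le (m : Method) {η τ q : ℝ} (hη : 0 < η) (hτ : 0 < τ)
    (hηq : η * (2 * q + τ) ≤ 1) {Q : Matrix A B ℝ} (hQ : ∀ a b, |Q a b| ≤ q)
    (hcard : Fintype.card B ≤ Fintype.card A) {μs : A → ℝ} {νs : B → ℝ}
    (hs : IsSaddle τ Q μs νs) {T : ℕ} (hT : 1 ≤ T) :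
    |regPayoff τ Q (m.run η τ Q T).μbar (m.run η τ Q T).νbar - regPayoff τ Q μs νs| ≤
      4 / η * Real.log (Fintype.card A) * (1 - η * τ) ^ T := by
  have hq : 0 ≤ q := (abs_nonneg _).trans (hQ (Classical.arbitrary A) (Classical.arbitrary B))
  have hρ : 0 ≤ 1 - η * τ := by nlinarith [mul_nonneg hη.le hq]
  -- The last step is split off because its surplus is what bounds the reverse divergences.
  obtain ⟨T, rfl⟩ : ∃ n, T = n + 1 := ⟨T - 1, by omega⟩
  have hx := m.isPos_run η τ Q T
  have hstep := m.potential_step_le hη.le hτ hηq hQ hs hx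
  have hprev := mul_le_mul_of_nonneg_left (m.potential_run_le hη.le hτ hηq hQ hcard hs T) hρ
  rw [Method.run_succ]
  have hy := m.isPos_step η τ Q hx
  set y := m.step η τ Q (m.run η τ Q T)
  set P := (1 - η * τ) ^ (T + 1) * (2 * Real.log (Fintype.card A)) with hP
  have hP' : (1 - η * τ) * ((1 - η * τ) ^ T * (2 * Real.log (Fintype.card A))) = P := by
    rw [hP]; ring
  have hμs := hs.isPosDist_left hτ
  have hνs := hs.isPosDist_right hτ
  have hk₁ := relEntropy_nonneg hy.μbar.mem_stdSimplex hμs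
  have hk₂ := relEntropy_nonneg hy.νbar.mem_stdSimplex hνs
  have hpot := y.potential_nonneg hs.left_mem hs.right_mem hy
  have hk := mul_nonneg (mul_nonneg hη.le hτ.le) (add_nonneg hk₁ hk₂)
  have hA := l1Dist_sq_le_of_triangle hy.μbar hy.μ hμs
  have hB := l1Dist_sq_le_of_triangle hy.νbar hy.ν hνs
  have hpotdef : y.potential μs νs = relEntropy μs y.μ + relEntropy νs y.ν
      + (relEntropy y.μbar y.μ + relEntropy y.νbar y.ν) := rfl
  have hbil := abs_dotProduct_mulVec_le hQ (y.μbar - μs) (y.νbar - νs)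
  -- The squared distances of the midpoints to the saddle point sum to at most four potentials, so
  -- their product is at most two.
  have hbil' : q * ((∑ a, |(y.μbar - μs) a|) * ∑ b, |(y.νbar - νs) b|) ≤
      q * (2 * y.potential μs νs) := by
    refine mul_le_mul_of_nonneg_left ?_ hq
    change l1Dist y.μbar μs * l1Dist y.νbar νs ≤ _
    nlinarith [sq_nonneg (l1Dist y.μbar μs - l1Dist y.νbar νs)]
  have hgap : |regPayoff τ Q y.μbar y.νbar - regPayoff τ Q μs νs| ≤
      2 * q * y.potential μs νs + τ * (relEntropy y.μbar μs + relEntropy y.νbar νs) := by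
    rw [hs.regPayoff_eq hτ hy.μbar.mem_stdSimplex hy.νbar.mem_stdSimplex]
    have h1 := abs_le.1 (hbil.trans hbil')
    have h2 := mul_nonneg hτ.le hk₁
    have h3 := mul_nonneg hτ.le hk₂
    rw [abs_le]
    constructor <;> linarith [h1.1, h1.2]
  -- By `2 * η * q ≤ 1`, the gap times `η` is at most the potential plus the surplus, which `hstep`
  -- bounds by `P`; the second `P` is slack.
  have hfin : η * |regPayoff τ Q y.μbar y.νbar - regPayoff τ Q μs νs| ≤ 2 * P := by
    have h1 := mul_le_mul_of_nonneg_left hgap hη.le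
    have h2 : 2 * (η * q) * y.potential μs νs ≤ 1 * y.potential μs νs :=
      mul_le_mul_of_nonneg_right (by nlinarith [mul_pos hη hτ]) hpot
    linarith
  have h4 : 4 / η * Real.log (Fintype.card A) * (1 - η * τ) ^ (T + 1) = 2 * P / η := by
    rw [hP]; field_simp; ring
  rw [h4, le_div_iff₀ hη]
  linarith

end InnerConvergence

/-! ### Averages over probability kernels and contractions on bounded functions. -/

section Kernels

variable {S : Type*}

theorem summable_mul_of_abs_le {L f : S → ℝ} {C : ℝ} (hL : Summable L) (h0 : ∀ s, 0 ≤ L s)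
    (hf : ∀ s, |f s| ≤ C) : Summable fun s => L s * f s := by
  refine Summable.of_norm_bounded (hL.mul_right C) fun s => ?_
  rw [Real.norm_eq_abs, abs_mul, abs_of_nonneg (h0 s)]
  exact mul_le_mul_of_nonneg_left (hf s) (h0 s)

theorem tsum_mul_le {L f : S → ℝ} {C c : ℝ} (hL : HasSum L 1) (h0 : ∀ s, 0 ≤ L s)
    (hf : ∀ s, |f s| ≤ C) (hc : ∀ s, f s ≤ c) : ∑' s, L s * f s ≤ c := by
  have h := (hL.mul_right c).summable
  calc ∑' s, L s * f s ≤ ∑' s, L s * c :=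
        (summable_mul_of_abs_le hL.summable h0 hf).tsum_le_tsum
          (fun s => mul_le_mul_of_nonneg_left (hc s) (h0 s)) h
    _ = c := by rw [(hL.mul_right c).tsum_eq, one_mul]

theorem abs_tsum_mul_le {L f : S → ℝ} {C : ℝ} (hL : HasSum L 1) (h0 : ∀ s, 0 ≤ L s)
    (hf : ∀ s, |f s| ≤ C) : |∑' s, L s * f s| ≤ C := by
  refine abs_le'.2 ⟨tsum_mul_le hL h0 hf fun s => (abs_le'.1 (hf s)).1, ?_⟩
  have h := tsum_mul_le (f := fun s => -f s) hL h0 (fun s => (abs_neg (f s)).le.trans (hf s))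
    fun s => (abs_le'.1 (hf s)).2
  simpa only [mul_neg, tsum_neg] using h

theorem summable_kernel_prod {L : S → ℝ} {K : S → S → ℝ} (hL : HasSum L 1)
    (hL0 : ∀ s, 0 ≤ L s) (hK : ∀ s, HasSum (K s) 1) (hK0 : ∀ s s', 0 ≤ K s s') :
    Summable fun p : S × S => L p.1 * K p.1 p.2 := by
  have h0 : 0 ≤ fun p : S × S => L p.1 * K p.1 p.2 := fun p => mul_nonneg (hL0 _) (hK0 _ _)
  rw [summable_prod_of_nonneg h0]
  refine ⟨fun s => (hK s).summable.mul_left (L s), ?_⟩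
  have h1 : (fun s => ∑' s', L s * K s s') = L := by
    funext s
    rw [tsum_mul_left, (hK s).tsum_eq, mul_one]
  change Summable fun s => ∑' s', L s * K s s'
  rw [h1]
  exact hL.summable

/-- Fubini, justified by summability of `L s * K s s'` over pairs and boundedness of `f`. -/
theorem tsum_kernel_comp {L f : S → ℝ} {K : S → S → ℝ} {C : ℝ} (hL : HasSum L 1)
    (hL0 : ∀ s, 0 ≤ L s) (hK : ∀ s, HasSum (K s) 1) (hK0 : ∀ s s', 0 ≤ K s s')
    (hf : ∀ s, |f s| ≤ C) :
    ∑' s', (∑' s, L s * K s s') * f s' = ∑' s, L s * ∑' s', K s s' * f s' := by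
  have h : Summable fun p : S × S => L p.1 * K p.1 p.2 * f p.2 :=
    summable_mul_of_abs_le (f := fun p : S × S => f p.2)
      (summable_kernel_prod hL hL0 hK hK0) (fun p => mul_nonneg (hL0 _) (hK0 _ _))
      fun p => hf p.2
  simp only [← tsum_mul_right, ← tsum_mul_left, ← mul_assoc]
  exact h.tsum_comm (f := fun s s' => L s * K s s' * f s')

theorem hasSum_kernel_comp {L : S → ℝ} {K : S → S → ℝ} (hL : HasSum L 1)
    (hL0 : ∀ s, 0 ≤ L s) (hK : ∀ s, HasSum (K s) 1) (hK0 : ∀ s s', 0 ≤ K s s') :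
    HasSum (fun s' => ∑' s, L s * K s s') 1 := by
  have h1 : Summable fun s' => ∑' s, L s * K s s' :=
    (summable_kernel_prod hL hL0 hK hK0).prod_symm.prod
  have h2 := tsum_kernel_comp (f := fun _ => 1) (C := 1) hL hL0 hK hK0 (by simp)
  simp only [mul_one, (hK _).tsum_eq, hL.tsum_eq] at h2
  exact h2 ▸ h1.hasSum

/-- Banach's fixed point theorem for operators on bounded functions. -/
theorem exists_bounded_fixedPoint {γ : ℝ} (h0 : 0 ≤ γ) (h1 : γ < 1) (F : (S → ℝ) → S → ℝ)
    (hbdd : ∀ V : S → ℝ, (∃ C, ∀ s, |V s| ≤ C) → ∃ C, ∀ s, |F V s| ≤ C)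
    (hF : ∀ V W : S → ℝ, (∃ C, ∀ s, |V s| ≤ C) → (∃ C, ∀ s, |W s| ≤ C) →
      ∀ c, (∀ s, |V s - W s| ≤ c) → ∀ s, |F V s - F W s| ≤ γ * c) :
    ∃ V : S → ℝ, (∃ C, ∀ s, |V s| ≤ C) ∧ ∀ s, V s = F V s := by
  -- With the discrete topology every bounded function is continuous, which makes the complete space
  -- of bounded continuous functions available.
  let _ : TopologicalSpace S := ⊥
  have _ : DiscreteTopology S := ⟨rfl⟩
  have hb : ∀ V : BoundedContinuousFunction S ℝ, ∃ C, ∀ s, |V s| ≤ C :=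
    fun V => ⟨‖V‖, V.norm_coe_le_norm⟩
  choose C hC using fun V : BoundedContinuousFunction S ℝ => hbdd V (hb V)
  let G : BoundedContinuousFunction S ℝ → BoundedContinuousFunction S ℝ := fun V =>
    BoundedContinuousFunction.ofNormedAddCommGroupDiscrete (F V) (C V) (hC V)
  have hG : ContractingWith ⟨γ, h0⟩ G := by
    refine ⟨by exact_mod_cast h1, LipschitzWith.of_dist_le_mul fun V W => ?_⟩
    refine (BoundedContinuousFunction.dist_le (mul_nonneg h0 dist_nonneg)).2 fun s => ?_
    exact hF V W (hb V) (hb W) (dist V W)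
      (fun s => BoundedContinuousFunction.dist_coe_le_dist (f := V) (g := W) s) s
  refine ⟨hG.fixedPoint, hb _, fun s => ?_⟩
  exact (DFunLike.congr_fun hG.fixedPoint_isFixedPt s).symm

/-- Iteration gives `D s ≤ γ ^ n * |C|` for all `n`. The one-sided form serves as a comparison
principle for Bellman inequalities. -/
theorem nonpos_of_contraction {γ C : ℝ} (h0 : 0 ≤ γ) (h1 : γ < 1) {D : S → ℝ}
    (hC : ∀ s, D s ≤ C) (h : ∀ c, 0 ≤ c → (∀ s, D s ≤ c) → ∀ s, D s ≤ γ * c) (s : S) :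
    D s ≤ 0 := by
  have hn : ∀ n : ℕ, ∀ s, D s ≤ γ ^ n * |C| := by
    intro n
    induction n with
    | zero => intro s; simpa using (hC s).trans (le_abs_self C)
    | succ n ih =>
      intro s
      rw [pow_succ', mul_assoc]
      exact h _ (by positivity) ih s
  have hlim := (tendsto_pow_atTop_nhds_zero_of_lt_one h0 h1).mul_const |C|
  rw [zero_mul] at hlim
  exact ge_of_tendsto' hlim fun n => hn n s

end Kernels

/-! ### Bellman equations, equilibria and error propagation in Markov games. -/

namespace MarkovGame

variable {S A B : Type*} (M : MarkovGame S A B)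

theorem backup_sub_le {V W : S → ℝ} {C C' c : ℝ} (hV : ∀ s, |V s| ≤ C) (hW : ∀ s, |W s| ≤ C')
    (h : ∀ s, V s - W s ≤ c) (s : S) (a : A) (b : B) :
    M.backup V s a b - M.backup W s a b ≤ M.γ * c := by
  have hs := (M.P_hasSum s a b).summable
  have hP := M.P_nonneg s a b
  have h1 : ∑' s', M.P s a b s' * V s' - ∑' s', M.P s a b s' * W s' =
      ∑' s', M.P s a b s' * (V s' - W s') := by
    rw [← (summable_mul_of_abs_le hs hP hV).tsum_sub (summable_mul_of_abs_le hs hP hW)]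
    simp only [mul_sub]
  have h2 : ∑' s', M.P s a b s' * (V s' - W s') ≤ c :=
    tsum_mul_le (C := C + C') (M.P_hasSum s a b) hP
      (fun s => (abs_sub _ _).trans (add_le_add (hV s) (hW s))) h
  have h3 := mul_le_mul_of_nonneg_left (h1.trans_le h2) M.γ_nonneg
  simp only [backup]
  linarith

theorem abs_backup_sub_le {V W : S → ℝ} {C C' c : ℝ} (hV : ∀ s, |V s| ≤ C)
    (hW : ∀ s, |W s| ≤ C') (h : ∀ s, |V s - W s| ≤ c) (s : S) (a : A) (b : B) :
    |M.backup V s a b - M.backup W s a b| ≤ M.γ * c := by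
  refine abs_le'.2 ⟨M.backup_sub_le hV hW (fun s => (abs_le'.1 (h s)).1) s a b, ?_⟩
  rw [neg_sub]
  exact M.backup_sub_le hW hV (fun s => by linarith [(abs_le'.1 (h s)).2]) s a b

theorem abs_backup_le {V : S → ℝ} {C : ℝ} (hV : ∀ s, |V s| ≤ C) (s : S) (a : A) (b : B) :
    |M.backup V s a b| ≤ 1 + M.γ * C := by
  have h1 := abs_tsum_mul_le (M.P_hasSum s a b) (M.P_nonneg s a b) hV
  have h2 : |M.r s a b| ≤ 1 := abs_le.2 ⟨by linarith [M.r_nonneg s a b], M.r_le_one s a b⟩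
  have h3 : |M.γ * ∑' s', M.P s a b s' * V s'| ≤ M.γ * C := by
    rw [abs_mul, abs_of_nonneg M.γ_nonneg]
    exact mul_le_mul_of_nonneg_left h1 M.γ_nonneg
  exact (abs_add_le _ _).trans (add_le_add h2 h3)

variable [Fintype A] [Fintype B]

theorem coe_mem {I : Type*} [Fintype I] (p : stdSimplex ℝ I) :
    (p : I → ℝ) ∈ stdSimplex ℝ I := p.2

/-- The transition probabilities of the state process under a pair of policies. -/
noncomputable def transition (μ : Policy S A) (ν : Policy S B) (s s' : S) : ℝ :=
  ∑ a, ∑ b, μ s a * ν s b * M.P s a b s'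

theorem transition_nonneg (μ : Policy S A) (ν : Policy S B) (s s' : S) :
    0 ≤ M.transition μ ν s s' :=
  sum_nonneg fun a _ => sum_nonneg fun b _ =>
    mul_nonneg (mul_nonneg ((μ s).2.1 a) ((ν s).2.1 b)) (M.P_nonneg _ _ _ _)

theorem sum_sum_mul_eq_one (μ : stdSimplex ℝ A) (ν : stdSimplex ℝ B) :
    ∑ a, ∑ b, μ a * ν b = 1 := by
  have h1 : ∑ a, μ a = 1 := μ.2.2
  have h2 : ∑ b, ν b = 1 := ν.2.2
  rw [← sum_mul_sum, h1, h2, one_mul]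

theorem hasSum_transition (μ : Policy S A) (ν : Policy S B) (s : S) :
    HasSum (M.transition μ ν s) 1 := by
  have h := hasSum_sum (s := (univ : Finset A)) fun a _ =>
    hasSum_sum (s := (univ : Finset B)) fun b _ =>
      (M.P_hasSum s a b).mul_left (μ s a * ν s b)
  simp only [mul_one, sum_sum_mul_eq_one] at h
  exact h

theorem tsum_transition_mul (μ : Policy S A) (ν : Policy S B) {V : S → ℝ} {C : ℝ}
    (hV : ∀ s, |V s| ≤ C) (s : S) :
    ∑' s', M.transition μ ν s s' * V s' =
      ∑ a, ∑ b, μ s a * ν s b * ∑' s', M.P s a b s' * V s' := by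
  have h := hasSum_sum (s := (univ : Finset A)) fun a _ =>
    hasSum_sum (s := (univ : Finset B)) fun b _ =>
      (summable_mul_of_abs_le (M.P_hasSum s a b).summable
        (M.P_nonneg s a b) hV).hasSum.mul_left (μ s a * ν s b)
  rw [← h.tsum_eq]
  refine tsum_congr fun s' => ?_
  simp only [transition, sum_mul, mul_assoc]

theorem stateLaw_nonneg (μ : Policy S A) (ν : Policy S B) (s₀ : S) (t : ℕ) (s : S) :
    0 ≤ M.stateLaw μ ν s₀ t s := by
  induction t generalizing s with
  | zero => unfold stateLaw; split_ifs <;> norm_num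
  | succ t ih => exact tsum_nonneg fun s' => mul_nonneg (ih s') (M.transition_nonneg μ ν s' s)

theorem hasSum_stateLaw (μ : Policy S A) (ν : Policy S B) (s₀ : S) (t : ℕ) :
    HasSum (M.stateLaw μ ν s₀ t) 1 := by
  induction t with
  | zero =>
    classical
    unfold stateLaw
    convert hasSum_ite_eq s₀ (1 : ℝ)
  | succ t ih =>
    exact hasSum_kernel_comp ih (M.stateLaw_nonneg μ ν s₀ t)
      (M.hasSum_transition μ ν) (M.transition_nonneg μ ν)

theorem tsum_stateLaw_succ (μ : Policy S A) (ν : Policy S B) (s₀ : S) (t : ℕ) {f : S → ℝ}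
    {C : ℝ} (hf : ∀ s, |f s| ≤ C) :
    ∑' s, M.stateLaw μ ν s₀ (t + 1) s * f s =
      ∑' s, M.stateLaw μ ν s₀ t s * ∑' s', M.transition μ ν s s' * f s' :=
  tsum_kernel_comp (M.hasSum_stateLaw μ ν s₀ t) (M.stateLaw_nonneg μ ν s₀ t)
    (M.hasSum_transition μ ν) (M.transition_nonneg μ ν) hf

theorem tsum_stateLaw_zero (μ : Policy S A) (ν : Policy S B) (s₀ : S) (f : S → ℝ) :
    ∑' s, M.stateLaw μ ν s₀ 0 s * f s = f s₀ := by
  rw [tsum_eq_single s₀ fun s hs => by simp [stateLaw, hs]]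
  simp [stateLaw]

theorem regReward_eq (τ : ℝ) (μ : Policy S A) (ν : Policy S B) (s : S) :
    M.regReward τ μ ν s = regPayoff τ (Matrix.of (M.r s)) (μ s) (ν s) := by
  have h1 : ∑ a, μ s a = 1 := (μ s).2.2
  have h2 : ∑ b, ν s b = 1 := (ν s).2.2
  have e1 : ∑ a, ∑ b, μ s a * ν s b * (τ * Real.log (μ s a)) =
      τ * ∑ a, μ s a * Real.log (μ s a) := by
    rw [mul_sum]
    refine sum_congr rfl fun a _ => ?_
    rw [← sum_mul, ← mul_sum, h2]
    ring
  have e2 : ∑ a, ∑ b, μ s a * ν s b * (τ * Real.log (ν s b)) =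
      τ * ∑ b, ν s b * Real.log (ν s b) := by
    rw [sum_comm, mul_sum]
    refine sum_congr rfl fun b _ => ?_
    rw [← sum_mul, ← sum_mul, h1]
    ring
  have e3 : ∑ a, ∑ b, μ s a * ν s b * M.r s a b =
      dotProduct (μ s : A → ℝ) ((Matrix.of (M.r s)).mulVec (ν s)) := by
    simp only [dotProduct, Matrix.mulVec, mul_sum, Matrix.of_apply]
    exact sum_congr rfl fun a _ => sum_congr rfl fun b _ => by ring
  simp only [regReward, mul_add, mul_sub, sum_add_distrib, sum_sub_distrib]
  rw [e1, e2, e3]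
  simp only [regPayoff, entropy]
  ring

/-- Passing from the matrix `r` to its backup leaves the entropies untouched and adds only the
expected continuation value. -/
theorem regPayoff_backup (τ : ℝ) (μ : Policy S A) (ν : Policy S B) {V : S → ℝ} {C : ℝ}
    (hV : ∀ s, |V s| ≤ C) (s : S) :
    regPayoff τ (M.backup V s) (μ s) (ν s) =
      M.regReward τ μ ν s + M.γ * ∑' s', M.transition μ ν s s' * V s' := by
  rw [M.regReward_eq, M.tsum_transition_mul μ ν hV, ← sub_eq_iff_eq_add',
    regPayoff_sub_regPayoff]
  simp only [dotProduct, Matrix.mulVec, mul_sum, Matrix.sub_apply, Matrix.of_apply, backup]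
  exact sum_congr rfl fun a _ => sum_congr rfl fun b _ => by ring

/-- A bounded solution of the Bellman equation of a pair of policies is its soft value. -/
theorem softV_eq_of_bellman {τ : ℝ} {μ : Policy S A} {ν : Policy S B} {W : S → ℝ} {C : ℝ}
    (hC : ∀ s, |W s| ≤ C) (hW : ∀ s, W s = regPayoff τ (M.backup W s) (μ s) (ν s)) :
    M.softV τ μ ν = W := by
  funext s₀
  set R := M.regReward τ μ ν with hR
  set KW : S → ℝ := fun s => ∑' s', M.transition μ ν s s' * W s' with hKW
  have hKWb : ∀ s, |KW s| ≤ C := fun s =>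
    abs_tsum_mul_le (M.hasSum_transition μ ν s) (M.transition_nonneg μ ν s) hC
  have hWR : ∀ s, W s = R s + M.γ * KW s := fun s =>
    (hW s).trans (M.regPayoff_backup τ μ ν hC s)
  -- The reward is bounded through the Bellman equation itself, without estimating entropies.
  have hRb : ∀ s, |R s| ≤ C + M.γ * C := by
    intro s
    have h1 : R s = W s - M.γ * KW s := by linarith [hWR s]
    rw [h1]
    refine (abs_sub _ _).trans (add_le_add (hC s) ?_)
    rw [abs_mul, abs_of_nonneg M.γ_nonneg]
    exact mul_le_mul_of_nonneg_left (hKWb s) M.γ_nonneg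
  set E : ℕ → (S → ℝ) → ℝ := fun n f => ∑' s, M.stateLaw μ ν s₀ n s * f s with hE
  have hEb : ∀ n (f : S → ℝ) (D : ℝ), (∀ s, |f s| ≤ D) → |E n f| ≤ D := fun n f D hf =>
    abs_tsum_mul_le (M.hasSum_stateLaw μ ν s₀ n) (M.stateLaw_nonneg μ ν s₀ n) hf
  have hEW : ∀ n, E n W = E n R + M.γ * E (n + 1) W := by
    intro n
    have hs := (M.hasSum_stateLaw μ ν s₀ n).summable
    have h0 := M.stateLaw_nonneg μ ν s₀ n
    have h1 : E (n + 1) W = E n KW := M.tsum_stateLaw_succ μ ν s₀ n hC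
    rw [h1]
    simp only [hE]
    rw [← tsum_mul_left, ← (summable_mul_of_abs_le hs h0 hRb).tsum_add
      ((summable_mul_of_abs_le hs h0 hKWb).mul_left M.γ)]
    refine tsum_congr fun s => ?_
    rw [hWR s]
    ring
  -- Unrolling the Bellman equation along the trajectory telescopes, with a remainder of size at
  -- most `γ ^ n * C`.
  have hpartial : ∀ n, ∑ t ∈ range n, M.γ ^ t * E t R = W s₀ - M.γ ^ n * E n W := by
    intro n
    induction n with
    | zero => simp [hE, M.tsum_stateLaw_zero]
    | succ n ih =>
      rw [sum_range_succ, ih, hEW n, pow_succ]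
      ring
  have hgeo := tendsto_pow_atTop_nhds_zero_of_lt_one M.γ_nonneg M.γ_lt_one
  have hrem : Tendsto (fun n => M.γ ^ n * E n W) atTop (𝓝 0) := by
    have h1 := hgeo.mul_const C
    rw [zero_mul] at h1
    refine squeeze_zero_norm (fun n => ?_) h1
    rw [Real.norm_eq_abs, abs_mul, abs_of_nonneg (pow_nonneg M.γ_nonneg n)]
    exact mul_le_mul_of_nonneg_left (hEb n W C hC) (pow_nonneg M.γ_nonneg n)
  have hsum : Summable fun t => M.γ ^ t * E t R := by
    refine Summable.of_norm_bounded
      ((summable_geometric_of_lt_one M.γ_nonneg M.γ_lt_one).mul_right (C + M.γ * C)) fun n => ?_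
    rw [Real.norm_eq_abs, abs_mul, abs_of_nonneg (pow_nonneg M.γ_nonneg n)]
    exact mul_le_mul_of_nonneg_left (hEb n R _ hRb) (pow_nonneg M.γ_nonneg n)
  have hlim : Tendsto (fun n => ∑ t ∈ range n, M.γ ^ t * E t R) atTop (𝓝 (W s₀)) := by
    simp only [hpartial]
    simpa using hrem.const_sub (W s₀)
  exact tendsto_nhds_unique hsum.hasSum.tendsto_sum_nat hlim

/-- All quantal response equilibria have the same value. -/
theorem IsQRE.softV_eq {τ : ℝ} {μ μ' : Policy S A} {ν ν' : Policy S B} (h : M.IsQRE τ μ ν)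
    (h' : M.IsQRE τ μ' ν') : M.softV τ μ ν = M.softV τ μ' ν' := by
  funext s
  exact le_antisymm (((h s).2 ν').trans ((h' s).1 μ)) (((h' s).2 ν).trans ((h s).1 μ'))

variable [Nonempty A] [Nonempty B]

/-- Policy evaluation is a contraction; its bounded fixed point is the soft value by
`softV_eq_of_bellman`, so it transfers both properties. -/
theorem exists_softV_bellman {τ : ℝ} (hτ : 0 ≤ τ) (hcard : Fintype.card B ≤ Fintype.card A)
    (μ : Policy S A) (ν : Policy S B) :
    (∃ C, ∀ s, |M.softV τ μ ν s| ≤ C) ∧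
      ∀ s, M.softV τ μ ν s = regPayoff τ (M.backup (M.softV τ μ ν) s) (μ s) (ν s) := by
  obtain ⟨W, ⟨C, hC⟩, hW⟩ := exists_bounded_fixedPoint M.γ_nonneg M.γ_lt_one
    (fun V s => regPayoff τ (M.backup V s) (μ s) (ν s))
    (fun V ⟨C, hC⟩ => ⟨_, fun s => abs_regPayoff_le hτ (M.abs_backup_le hC s) hcard
      (coe_mem (μ s)) (coe_mem (ν s))⟩)
    (fun V W ⟨C, hC⟩ ⟨C', hC'⟩ c hc s => abs_regPayoff_sub_le τ
      (M.abs_backup_sub_le hC hC' hc s) (coe_mem (μ s)) (coe_mem (ν s)))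
  rw [M.softV_eq_of_bellman hC hW]
  exact ⟨⟨C, hC⟩, hW⟩

/-- Statewise saddle points at a fixed point of the optimal Bellman operator form a quantal response
equilibrium. -/
theorem isQRE_of_isSaddle {τ : ℝ} (hτ : 0 ≤ τ) (hcard : Fintype.card B ≤ Fintype.card A)
    {μ : Policy S A} {ν : Policy S B} {V : S → ℝ} {C : ℝ} (hC : ∀ s, |V s| ≤ C)
    (hV : ∀ s, V s = regPayoff τ (M.backup V s) (μ s) (ν s))
    (hs : ∀ s, IsSaddle τ (M.backup V s) (μ s) (ν s)) : M.IsQRE τ μ ν := by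
  have hVeq := M.softV_eq_of_bellman hC hV
  intro s
  rw [hVeq]
  refine ⟨fun μ' => ?_, fun ν' => ?_⟩
  · obtain ⟨⟨C', hC'⟩, hW⟩ := M.exists_softV_bellman hτ hcard μ' ν
    set W := M.softV τ μ' ν
    refine sub_nonpos.1 (nonpos_of_contraction (D := fun s => W s - V s) (C := C' + C)
      M.γ_nonneg M.γ_lt_one (fun s => ?_) (fun c _ hc s => ?_) s)
    · linarith [(abs_le.1 (hC' s)).2, (abs_le.1 (hC s)).1]
    -- Replacing `W` by `V` inside the backup costs `γ * c`, and against the backup of `V` the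
    -- deviation `μ'` cannot beat the saddle point.
    · have h1 := regPayoff_sub_le τ (M.backup_sub_le hC' hC hc s)
        (coe_mem (μ' s)) (coe_mem (ν s))
      have h2 := (hs s).le_left _ (coe_mem (μ' s))
      have h3 := hW s
      have h4 := hV s
      linarith
  · obtain ⟨⟨C', hC'⟩, hW⟩ := M.exists_softV_bellman hτ hcard μ ν'
    set W := M.softV τ μ ν'
    refine sub_nonpos.1 (nonpos_of_contraction (D := fun s => V s - W s) (C := C + C')
      M.γ_nonneg M.γ_lt_one (fun s => ?_) (fun c _ hc s => ?_) s)
    · linarith [(abs_le.1 (hC' s)).1, (abs_le.1 (hC s)).2]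
    · have h1 := regPayoff_sub_le τ (M.backup_sub_le hC hC' hc s)
        (coe_mem (μ s)) (coe_mem (ν' s))
      have h2 := (hs s).le_right _ (coe_mem (ν' s))
      have h3 := hW s
      have h4 := hV s
      linarith

/-- The optimal Bellman equation has a bounded solution, attained by statewise saddle points. -/
theorem exists_optimal_value {τ : ℝ} (hτ : 0 < τ) (hcard : Fintype.card B ≤ Fintype.card A) :
    ∃ (V : S → ℝ) (μ : Policy S A) (ν : Policy S B), (∃ C, ∀ s, |V s| ≤ C) ∧
      (∀ s, V s = regPayoff τ (M.backup V s) (μ s) (ν s)) ∧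
      ∀ s, IsSaddle τ (M.backup V s) (μ s) (ν s) := by
  -- One saddle point is fixed per matrix. No regularity of this choice is needed, since the saddle
  -- value is nonexpansive for any choice.
  choose f g hfg using exists_isSaddle (A := A) (B := B) hτ
  obtain ⟨V, hC, hV⟩ := exists_bounded_fixedPoint M.γ_nonneg M.γ_lt_one
    (fun V s => regPayoff τ (M.backup V s) (f (M.backup V s)) (g (M.backup V s)))
    (fun V ⟨C, hC⟩ => ⟨_, fun s => abs_regPayoff_le hτ.le (M.abs_backup_le hC s) hcard
      (hfg _).left_mem (hfg _).right_mem⟩)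
    (fun V W ⟨C, hC⟩ ⟨C', hC'⟩ c hc s =>
      (hfg _).abs_regPayoff_sub_le (hfg _) (M.abs_backup_sub_le hC hC' hc s))
  exact ⟨V, fun s => ⟨f (M.backup V s), (hfg _).left_mem⟩,
    fun s => ⟨g (M.backup V s), (hfg _).right_mem⟩, hC, hV, fun s => hfg _⟩

/-- The bound `v` solves `v = 1 + τ * log |A| + γ * v`, so the excess `|V| - v` contracts. -/
theorem abs_optimal_value_le {τ : ℝ} (hτ : 0 ≤ τ) (hcard : Fintype.card B ≤ Fintype.card A)
    {μ : Policy S A} {ν : Policy S B} {V : S → ℝ} {C : ℝ} (hC : ∀ s, |V s| ≤ C)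
    (hV : ∀ s, V s = regPayoff τ (M.backup V s) (μ s) (ν s)) (s : S) :
    |V s| ≤ (1 + τ * Real.log (Fintype.card A)) / (1 - M.γ) := by
  have hγ : 0 < 1 - M.γ := sub_pos.2 M.γ_lt_one
  set v := (1 + τ * Real.log (Fintype.card A)) / (1 - M.γ) with hv
  have hv' : (1 - M.γ) * v = 1 + τ * Real.log (Fintype.card A) := by
    rw [hv]; field_simp
  refine sub_nonpos.1 (nonpos_of_contraction (D := fun s => |V s| - v) (C := C - v)
      M.γ_nonneg M.γ_lt_one (fun s => sub_le_sub_right (hC s) v) (fun c _ hc s => ?_) s)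
  have h1 := abs_regPayoff_le hτ
    (M.abs_backup_le (C := c + v) (fun s => by linarith [hc s]) s) hcard
    (coe_mem (μ s)) (coe_mem (ν s))
  rw [← hV s] at h1
  linarith

/-- The box of radius `q` is invariant merely because the midpoints are distributions; no
convergence of the inner method enters. This gives one `q` for all inner games. -/
theorem abs_approxVI_le {τ q : ℝ} (hτ : 0 ≤ τ) (hcard : Fintype.card B ≤ Fintype.card A)
    (hq0 : 0 ≤ q) (hq : 1 + M.γ * (q + τ * Real.log (Fintype.card A)) ≤ q) (m : Method)
    (η : ℝ) (T t : ℕ) (s : S) (a : A) (b : B) : |M.approxVI m η τ T t s a b| ≤ q := by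
  induction t generalizing s a b with
  | zero => simpa [approxVI] using hq0
  | succ t ih =>
    refine (M.abs_backup_le (C := q + τ * Real.log (Fintype.card A)) (fun s => ?_) s a b).trans hq
    have hpos := m.isPos_run η τ (M.approxVI m η τ T t s) T
    exact abs_regPayoff_le hτ (ih s) hcard hpos.μbar.mem_stdSimplex hpos.νbar.mem_stdSimplex

/-- Error bound for approximate soft value iteration when the inner method has accuracy `δ`. -/
theorem abs_approxVI_sub_le {τ q η δ : ℝ} (hτ : 0 < τ)
    (hcard : Fintype.card B ≤ Fintype.card A)
    (hq : (1 - M.γ) * q = 1 + M.γ * (τ * Real.log (Fintype.card A)))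
    {μ : Policy S A} {ν : Policy S B} {V : S → ℝ} {C : ℝ} (hC : ∀ s, |V s| ≤ C)
    (hV : ∀ s, V s = regPayoff τ (M.backup V s) (μ s) (ν s))
    (hs : ∀ s, IsSaddle τ (M.backup V s) (μ s) (ν s)) (m : Method) (T : ℕ) (hδ0 : 0 ≤ δ)
    (hδ : ∀ (Q : Matrix A B ℝ), (∀ a b, |Q a b| ≤ q) → ∀ (μs : A → ℝ) (νs : B → ℝ),
      IsSaddle τ Q μs νs →
      |regPayoff τ Q (m.run η τ Q T).μbar (m.run η τ Q T).νbar - regPayoff τ Q μs νs| ≤ δ)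
    (t : ℕ) (s : S) (a : A) (b : B) :
    |M.approxVI m η τ T t s a b - M.backup V s a b| ≤ M.γ ^ t * q + δ / (1 - M.γ) := by
  have hγ : 0 < 1 - M.γ := sub_pos.2 M.γ_lt_one
  have hlog : 0 ≤ Real.log (Fintype.card A) :=
    Real.log_nonneg (by exact_mod_cast Fintype.card_pos)
  have hq0 : 0 ≤ q := by
    have := M.γ_nonneg
    exact nonneg_of_mul_nonneg_right (hq ▸ by positivity) hγ
  set d := δ / (1 - M.γ) with hd
  have hd' : (1 - M.γ) * d = δ := by rw [hd]; field_simp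
  have hd0 : 0 ≤ d := div_nonneg hδ0 hγ.le
  induction t generalizing s a b with
  | zero =>
    -- Since `Q^(0) = 0`, the initial error is the size of the optimal backup, and `q` is exactly
    -- the bound for it.
    have h1 := M.abs_backup_le (M.abs_optimal_value_le hτ.le hcard hC hV) s a b
    have h2 : 1 + M.γ * ((1 + τ * Real.log (Fintype.card A)) / (1 - M.γ)) = q := by
      rw [← mul_left_cancel_iff_of_pos hγ, hq]
      field_simp
      ring
    rw [h2] at h1
    simp only [approxVI, Matrix.zero_apply, zero_sub, abs_neg, pow_zero, one_mul]
    linarith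
  | succ t ih =>
    have hQ := M.abs_approxVI_le hτ.le hcard hq0 (by linarith) m η T t
    have h := M.abs_backup_sub_le
      (V := fun s => regPayoff τ (M.approxVI m η τ T t s)
        (m.run η τ (M.approxVI m η τ T t s) T).μbar
        (m.run η τ (M.approxVI m η τ T t s) T).νbar) (W := V)
      (C := q + τ * Real.log (Fintype.card A)) (C' := C) (c := δ + (M.γ ^ t * q + d))
      (fun s => ?_) hC (fun s => ?_) s a b
    · refine h.trans ?_
      rw [pow_succ']
      -- With `δ = (1 - γ) * d` the left side equals `(1 - (1 - γ) ^ 2) * d`.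
      have : M.γ * (δ + d) ≤ d := by
        rw [← hd']
        nlinarith [M.γ_nonneg, mul_nonneg hd0 (sq_nonneg (1 - M.γ))]
      linarith
    · have hpos := m.isPos_run η τ (M.approxVI m η τ T t s) T
      exact abs_regPayoff_le hτ.le (hQ s) hcard hpos.μbar.mem_stdSimplex
        hpos.νbar.mem_stdSimplex
    · obtain ⟨μs, νs, hsad⟩ := exists_isSaddle hτ (M.approxVI m η τ T t s)
      have h1 := hδ _ (hQ s) μs νs hsad
      have h2 := hsad.abs_regPayoff_sub_le (hs s) (ih s)
      rw [← hV s] at h2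
      exact (abs_sub_le _ _ _).trans (add_le_add h1 h2)

end MarkovGame

/-! ### Existence of equilibria and the combined error bound. -/

namespace MarkovGame

variable {S A B : Type*} [Fintype A] [Fintype B] [Nonempty A] [Nonempty B]
  (M : MarkovGame S A B)

theorem exists_isQRE {τ : ℝ} (hτ : 0 < τ) (hcard : Fintype.card B ≤ Fintype.card A) :
    ∃ (μ : Policy S A) (ν : Policy S B), M.IsQRE τ μ ν := by
  obtain ⟨V, μ, ν, ⟨C, hC⟩, hV, hs⟩ := M.exists_optimal_value hτ hcard
  exact ⟨μ, ν, M.isQRE_of_isSaddle hτ.le hcard hC hV hs⟩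

/-- Error of approximate soft value iteration after `t` outer and `T` inner iterations. -/
theorem abs_approxVI_sub_softQ_le {τ q η : ℝ} (hτ : 0 < τ) (hη : 0 < η)
    (hcard : Fintype.card B ≤ Fintype.card A)
    (hq : (1 - M.γ) * q = 1 + M.γ * (τ * Real.log (Fintype.card A)))
    (hηq : η * (2 * q + τ) ≤ 1) (hητ : η * τ ≤ 1) {μ : Policy S A} {ν : Policy S B}
    (h : M.IsQRE τ μ ν)
    (m : Method) {T : ℕ} (hT : 1 ≤ T) (t : ℕ) (s : S) (a : A) (b : B) :
    |M.approxVI m η τ T t s a b - M.softQ τ μ ν s a b| ≤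
      M.γ ^ t * q + 4 / η * Real.log (Fintype.card A) * (1 - η * τ) ^ T / (1 - M.γ) := by
  obtain ⟨V, μ', ν', ⟨C, hC⟩, hV, hs⟩ := M.exists_optimal_value hτ hcard
  have hQRE := M.isQRE_of_isSaddle hτ.le hcard hC hV hs
  have hlog : 0 ≤ Real.log (Fintype.card A) :=
    Real.log_nonneg (by exact_mod_cast Fintype.card_pos)
  have hpow : 0 ≤ (1 - η * τ) ^ T := pow_nonneg (by linarith) T
  -- The given equilibrium is exchanged for the constructed one, which has the same value.
  rw [softQ, h.softV_eq M hQRE, M.softV_eq_of_bellman hC hV]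
  exact M.abs_approxVI_sub_le hτ hcard hq hC hV hs m T (by positivity)
    (fun Q hQ μs νs hsad => m.abs_regPayoff_run_sub_le hη hτ hηq hQ hcard hsad hT) t s a b

end MarkovGame

/-! ### Choice of iteration counts and numerical constants. -/

theorem one_sub_pow_le_exp {x c : ℝ} (hx : x ≤ 1) {T : ℕ} (h : c ≤ x * T) :
    (1 - x) ^ T ≤ Real.exp (-c) := by
  calc (1 - x) ^ T ≤ Real.exp (-x) ^ T :=
        pow_le_pow_left₀ (by linarith) (Real.one_sub_le_exp_neg x) T
    _ = Real.exp (-(x * T)) := by rw [← Real.exp_nat_mul]; ring_nf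
    _ ≤ Real.exp (-c) := Real.exp_le_exp.2 (by linarith)

theorem log_two_le_log_natCast {k : ℕ} (hk : 2 ≤ k) : 0.69 ≤ Real.log k := by
  have h1 : Real.log 2 ≤ Real.log k := Real.log_le_log two_pos (by exact_mod_cast hk)
  linarith [Real.log_two_gt_d9]

section Parameters

variable {l γ τ ε : ℝ}

/-- The ratio is at least `0.69 / (1 / 2) = 1.38`, and `log x ≥ 1 - 1 / x`. Keeping `L` away from
`0` lets multiples of `L` absorb constants and ceilings. -/
theorem quarter_le_log_div (hl : 0.69 ≤ l) (h0 : 0 ≤ γ) (h1 : γ < 1) (hε : 0 < ε)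
    (hε' : ε ≤ 1 / 2) : 1 / 4 ≤ Real.log (l / ((1 - γ) * ε)) := by
  have hd : 0 < (1 - γ) * ε := mul_pos (by linarith) hε
  have hx : 1.38 ≤ l / ((1 - γ) * ε) := by
    rw [le_div_iff₀ hd]
    nlinarith
  have h := Real.one_sub_inv_le_log_of_pos (by linarith : 0 < l / ((1 - γ) * ε))
  have h2 : (l / ((1 - γ) * ε))⁻¹ ≤ (1.38 : ℝ)⁻¹ := inv_anti₀ (by norm_num) hx
  have h3 : (1.38 : ℝ)⁻¹ ≤ 3 / 4 := by norm_num
  linarith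

/-- The initial error is at most `5 / 2 * l / (1 - γ) = 5 / 2 * exp L * ε`, so the decay `exp (-10 *
L)` leaves `5 * exp (-9 * L) ≤ 1` times `ε / 2`. -/
theorem outer_error_le (hl : 0.69 ≤ l) (h0 : 0 ≤ γ) (h1 : γ < 1) (hτ : 0 < τ) (hτ' : τ ≤ 1)
    (hε : 0 < ε) (hε' : ε ≤ 1 / 2) {T : ℕ}
    (hT : 10 * Real.log (l / ((1 - γ) * ε)) / (1 - γ) ≤ T) :
    γ ^ T * ((1 + γ * (τ * l)) / (1 - γ)) ≤ ε / 2 := by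
  have hγ : 0 < 1 - γ := by linarith
  have hd : 0 < (1 - γ) * ε := mul_pos hγ hε
  have hL := quarter_le_log_div hl h0 h1 hε hε'
  have hxpos : 0 < l / ((1 - γ) * ε) := div_pos (by linarith) hd
  set L := Real.log (l / ((1 - γ) * ε)) with hLdef
  have hx : l / (1 - γ) = Real.exp L * ε := by
    rw [hLdef, Real.exp_log hxpos]; field_simp
  have hpow : γ ^ T ≤ Real.exp (-(10 * L)) := by
    rw [div_le_iff₀' hγ] at hT
    simpa using one_sub_pow_le_exp (x := 1 - γ) (by linarith) hT
  have hq : (1 + γ * (τ * l)) / (1 - γ) ≤ 5 / 2 * (Real.exp L * ε) := by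
    rw [← hx, ← mul_div_assoc]
    refine div_le_div_of_nonneg_right ?_ hγ.le
    have : γ * (τ * l) ≤ 1 * (1 * l) := by gcongr
    linarith
  have hexp : 5 ≤ Real.exp (9 * L) := by
    have h2 : Real.exp 1 ^ 2 ≤ Real.exp (9 * L) := by
      rw [← Real.exp_nat_mul]
      exact Real.exp_le_exp.2 (by push_cast; linarith)
    nlinarith [Real.exp_one_gt_d9]
  calc γ ^ T * ((1 + γ * (τ * l)) / (1 - γ))
      ≤ Real.exp (-(10 * L)) * (5 / 2 * (Real.exp L * ε)) := by
        gcongr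
    _ = 5 * (Real.exp (-(10 * L)) * Real.exp L) * (ε / 2) := by ring
    _ = 5 / Real.exp (9 * L) * (ε / 2) := by
        rw [← Real.exp_add, show -(10 * L) + L = -(9 * L) by ring, Real.exp_neg]
        ring
    _ ≤ 1 * (ε / 2) := by
        refine mul_le_mul_of_nonneg_right ?_ (by linarith)
        exact (div_le_one (Real.exp_pos _)).2 hexp
    _ = ε / 2 := one_mul _

/-- Since `4 / η ≤ 32 * l / (1 - γ)`, the error is at most `32 * (exp L * ε) ^ 2 * exp (-20 * L)`.
Here `32 * exp (-18 * L) ≤ 1`, and `ε ^ 2 ≤ ε / 2` uses `ε ≤ 1 / 2`. -/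
theorem inner_error_le {η : ℝ} (hl : 0.69 ≤ l) (h0 : 0 ≤ γ) (h1 : γ < 1) (hτ : 0 < τ)
    (hτ' : τ ≤ 1) (hε : 0 < ε) (hε' : ε ≤ 1 / 2)
    (hη : η = (1 - γ) / (2 * (1 + τ * (l + 1 - γ)))) (hητ : η * τ ≤ 1) {T : ℕ}
    (hT : 20 * Real.log (l / ((1 - γ) * ε)) / (η * τ) ≤ T) :
    4 / η * l * (1 - η * τ) ^ T / (1 - γ) ≤ ε / 2 := by
  have hγ : 0 < 1 - γ := by linarith
  have hd : 0 < (1 - γ) * ε := mul_pos hγ hε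
  have hL := quarter_le_log_div hl h0 h1 hε hε'
  have hxpos : 0 < l / ((1 - γ) * ε) := div_pos (by linarith) hd
  have hden : 0 < 1 + τ * (l + 1 - γ) := by
    have := mul_pos hτ (by linarith : 0 < l + 1 - γ)
    linarith
  have hηpos : 0 < η := by rw [hη]; positivity
  set L := Real.log (l / ((1 - γ) * ε)) with hLdef
  have hx : l / (1 - γ) = Real.exp L * ε := by
    rw [hLdef, Real.exp_log hxpos]; field_simp
  have hpow : (1 - η * τ) ^ T ≤ Real.exp (-(20 * L)) := by
    rw [div_le_iff₀' (mul_pos hηpos hτ)] at hT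
    exact one_sub_pow_le_exp hητ hT
  have hinv : 4 / η ≤ 32 * (l / (1 - γ)) := by
    have h2 : 4 / η = 8 * (1 + τ * (l + 1 - γ)) / (1 - γ) := by
      rw [hη]; field_simp; ring
    rw [h2, ← mul_div_assoc]
    refine div_le_div_of_nonneg_right ?_ hγ.le
    have : τ * (l + 1 - γ) ≤ 1 * (l + 1 - γ) := by gcongr; linarith
    linarith
  have hexp : 32 ≤ Real.exp (18 * L) := by
    have h2 : Real.exp 1 ^ 4 ≤ Real.exp (18 * L) := by
      rw [← Real.exp_nat_mul]
      exact Real.exp_le_exp.2 (by push_cast; linarith)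
    have h3 : (2.7 : ℝ) ^ 4 ≤ Real.exp 1 ^ 4 :=
      pow_le_pow_left₀ (by norm_num) (by linarith [Real.exp_one_gt_d9]) 4
    have h5 : (32 : ℝ) ≤ 2.7 ^ 4 := by norm_num
    linarith
  calc 4 / η * l * (1 - η * τ) ^ T / (1 - γ)
      = 4 / η * (l / (1 - γ)) * (1 - η * τ) ^ T := by ring
    _ ≤ 32 * (l / (1 - γ)) * (l / (1 - γ)) * Real.exp (-(20 * L)) := by
        have : 0 ≤ l / (1 - γ) := div_nonneg (by linarith) hγ.le
        gcongr
    _ = 32 * (Real.exp L * Real.exp L * Real.exp (-(20 * L))) * (ε * ε) := by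
        rw [hx]; ring
    _ = 32 / Real.exp (18 * L) * (ε * ε) := by
        rw [← Real.exp_add, ← Real.exp_add, show L + L + -(20 * L) = -(18 * L) by ring,
          Real.exp_neg]
        ring
    _ ≤ 1 * (ε * ε) := by
        refine mul_le_mul_of_nonneg_right ?_ (by positivity)
        exact (div_le_one (Real.exp_pos _)).2 hexp
    _ ≤ ε / 2 := by nlinarith

/-- Because `4 * L ≥ 1`, each rounding up costs only a multiple of `L`: the factors become `14` and
`96`, with product `1344`. -/
theorem mul_ceil_le {η L : ℝ} (hl : 0.69 ≤ l) (h0 : 0 ≤ γ) (h1 : γ < 1) (hτ : 0 < τ)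
    (hτ' : τ ≤ 1) (hη : η = (1 - γ) / (2 * (1 + τ * (l + 1 - γ)))) (hL : 1 / 4 ≤ L) :
    ((⌈10 * L / (1 - γ)⌉₊ * ⌈20 * L / (η * τ)⌉₊ : ℕ) : ℝ) ≤
      1344 * ((l + 1 / τ) / (1 - γ) ^ 2 * L ^ 2) := by
  have hγ : 0 < 1 - γ := by linarith
  have hden : 0 < 1 + τ * (l + 1 - γ) := by
    have := mul_pos hτ (by linarith : 0 < l + 1 - γ)
    linarith
  have hηpos : 0 < η := by rw [hη]; positivity
  have hτinv : 1 ≤ 1 / τ := by rw [le_div_iff₀ hτ]; linarith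
  have hγinv : 1 ≤ 1 / (1 - γ) := by rw [le_div_iff₀ hγ]; linarith
  have h2 : (⌈10 * L / (1 - γ)⌉₊ : ℝ) ≤ 14 * L * (1 / (1 - γ)) := by
    have h3 := (Nat.ceil_lt_add_one (by positivity : 0 ≤ 10 * L / (1 - γ))).le
    have h4 : 10 * L / (1 - γ) = 10 * L * (1 / (1 - γ)) := by ring
    nlinarith
  have hw : 1 / (η * τ) ≤ 4 * ((l + 1 / τ) * (1 / (1 - γ))) := by
    have h5 : 1 / (η * τ) = 2 * (1 / τ + l + 1 - γ) * (1 / (1 - γ)) := by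
      rw [hη]; field_simp; ring
    rw [h5, ← mul_assoc]
    exact mul_le_mul_of_nonneg_right (by linarith) (by linarith)
  have hW : 1 ≤ (l + 1 / τ) * (1 / (1 - γ)) := one_le_mul_of_one_le_of_one_le (by linarith) hγinv
  have h6 : (⌈20 * L / (η * τ)⌉₊ : ℝ) ≤ 96 * L * ((l + 1 / τ) * (1 / (1 - γ))) := by
    have h3 := (Nat.ceil_lt_add_one (by positivity : 0 ≤ 20 * L / (η * τ))).le
    have h4 : 20 * L / (η * τ) = 20 * L * (1 / (η * τ)) := by ring
    have h7 := mul_le_mul_of_nonneg_left hw (by linarith : 0 ≤ 20 * L)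
    nlinarith
  push_cast
  calc (⌈10 * L / (1 - γ)⌉₊ : ℝ) * ⌈20 * L / (η * τ)⌉₊
      ≤ 14 * L * (1 / (1 - γ)) * (96 * L * ((l + 1 / τ) * (1 / (1 - γ)))) :=
        mul_le_mul h2 h6 (Nat.cast_nonneg _) (by positivity)
    _ = 1344 * ((l + 1 / τ) / (1 - γ) ^ 2 * L ^ 2) := by field_simp; ring

/-- This is where the prescribed learning rate comes from: it meets the step-size condition for the
invariant radius `q = (1 + γ * τ * l) / (1 - γ)`. -/
theorem learningRate_mul_le {η : ℝ} (hl : 0.69 ≤ l) (h1 : γ < 1) (hτ : 0 < τ)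
    (hη : η = (1 - γ) / (2 * (1 + τ * (l + 1 - γ)))) :
    η * (2 * ((1 + γ * (τ * l)) / (1 - γ)) + τ) ≤ 1 := by
  have hγ : 0 < 1 - γ := by linarith
  have hden : 0 < 1 + τ * (l + 1 - γ) := by
    have := mul_pos hτ (by linarith : 0 < l + 1 - γ)
    linarith
  have h2 : η * (2 * ((1 + γ * (τ * l)) / (1 - γ)) + τ) =
      (2 * (1 + γ * (τ * l)) + (1 - γ) * τ) / (2 * (1 + τ * (l + 1 - γ))) := by
    rw [hη]; field_simp
  rw [h2, div_le_one (by positivity)]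
  nlinarith [mul_pos hγ hτ, mul_pos (mul_pos hγ hτ) (by linarith : 0 < l)]

end Parameters

end EntropyGame

theorem mainTheorem2 :
    ∃ C : ℝ, 0 < C ∧
      ∀ (k : ℕ) (γ τ ε : ℝ), 2 ≤ k → 0 ≤ γ → γ < 1 → 0 < τ → τ ≤ 1 → 0 < ε → ε ≤ 1 / 2 →
        ∃ Tmain Tsub : ℕ, 1 ≤ Tmain ∧ 1 ≤ Tsub ∧
          ((Tmain * Tsub : ℕ) : ℝ) ≤
            C * ((Real.log k + 1 / τ) / (1 - γ) ^ 2 *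
              (Real.log (Real.log k / ((1 - γ) * ε))) ^ 2) ∧
          ∀ (S : Type*) (A : Type*) (B : Type*) [Fintype A] [Fintype B] [Nonempty B],
            Fintype.card A = k → Fintype.card B ≤ Fintype.card A →
            ∀ M : EntropyGame.MarkovGame S A B, M.γ = γ →
              (∃ (μ : EntropyGame.Policy S A) (ν : EntropyGame.Policy S B), M.IsQRE τ μ ν) ∧
              ∀ (μ : EntropyGame.Policy S A) (ν : EntropyGame.Policy S B), M.IsQRE τ μ ν →
                ∀ (m : EntropyGame.Method) (η : ℝ),
                  η = (1 - γ) / (2 * (1 + τ * (Real.log k + 1 - γ))) →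
                  ∀ T T' : ℕ, Tmain ≤ T → Tsub ≤ T' →
                    ∀ s a b, |M.approxVI m η τ T' T s a b - M.softQ τ μ ν s a b| ≤ ε := by
  refine ⟨1344, by norm_num, fun k γ τ ε hk h0 h1 hτ hτ' hε hε' => ?_⟩
  have hl := EntropyGame.log_two_le_log_natCast hk
  have hL := EntropyGame.quarter_le_log_div hl h0 h1 hε hε'
  have hγ : 0 < 1 - γ := by linarith
  have hηpos : 0 < (1 - γ) / (2 * (1 + τ * (Real.log k + 1 - γ))) := by
    have := mul_pos hτ (by linarith : 0 < Real.log k + 1 - γ)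
    positivity
  refine ⟨⌈10 * Real.log (Real.log k / ((1 - γ) * ε)) / (1 - γ)⌉₊,
    ⌈20 * Real.log (Real.log k / ((1 - γ) * ε)) /
      ((1 - γ) / (2 * (1 + τ * (Real.log k + 1 - γ))) * τ)⌉₊,
    Nat.ceil_pos.2 (div_pos (by linarith) hγ),
    Nat.ceil_pos.2 (div_pos (by linarith) (mul_pos hηpos hτ)),
    EntropyGame.mul_ceil_le hl h0 h1 hτ hτ' rfl hL, ?_⟩
  intro S A B _ _ _ hA hcard M hM
  have hAne : Nonempty A := Fintype.card_pos_iff.1 (by omega)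
  refine ⟨M.exists_isQRE hτ hcard, ?_⟩
  intro μ ν hQRE m η hη T T' hT hT' s a b
  rw [← hη] at hηpos hT'
  subst hM
  subst hA
  have hηq := EntropyGame.learningRate_mul_le hl h1 hτ hη
  have hητ : η * τ ≤ 1 := by
    have : 0 ≤ (1 + M.γ * (τ * Real.log (Fintype.card A))) / (1 - M.γ) := by positivity
    nlinarith
  -- At least one inner iteration is required, since the value estimate uses the surplus of a last
  -- step.
  have hT1 : 1 ≤ T' :=
    (Nat.ceil_pos.2 (div_pos (by linarith) (mul_pos hηpos hτ))).trans_le hT'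
  have h := M.abs_approxVI_sub_softQ_le hτ hηpos hcard (by field_simp) hηq hητ hQRE m hT1 T s a b
  have h2 := EntropyGame.outer_error_le hl h0 h1 hτ hτ' hε hε' (Nat.ceil_le.1 hT)
  have h3 := EntropyGame.inner_error_le hl h0 h1 hτ hτ' hε hε' hη hητ (Nat.ceil_le.1 hT')
  linarith
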